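/- All rings are commutative of characteristic $0$. A difference ring $(A,\sigma)$ is a ring with a ring automorphism $\sigma$; $\mathrm{const}(A,\sigma)=\{c\in A\mid\sigma(c)=c\}$; a difference ring homomorphism is a ring homomorphism commuting with the automorphisms. For a field $K$ let $S(K)$ be the ring of sequences $K^{\mathbb N}$ modulo equality from some point on, with the shift automorphism $S$. If $K$ is a subfield of $A$ consisting of constants, a $K$-homomorphism (resp. $K$-embedding) $A\to S(K)$ is a (resp. injective) difference ring homomorphism $(A,\sigma)\to(S(K),S)$ with $c\mapsto(c,c,\dots)$ for $c\in K$. A $P$-extension of $(A,\sigma)$ is a Laurent polynomial ring $A\langle x_1\rangle\dots\langle x_r\rangle$ with an automorphism extending $\sigma$ and $\sigma(x_i)=\alpha_ix_i$; here always $\alpha_i\in A^*$. An $A$-extension of order $n>1$ is a ring $A[z]$ subject to $z^n=1$ (free over $A$ with basis $1,\dots,z^{n-1}$) with an automorphism extending $\sigma$, $\sigma(z)=\rho z$ and $\rho\in A^*$, $\rho^n=1$. They are called $\Pi$-extension and $R$-extension, respectively, if there are no new constants. A difference field $(F,\sigma)$ with $K=\mathrm{const}(F,\sigma)$ is radical-stable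 if for all $a\in F^*$, $m\ge1$ with $a^m\in\{\sigma(g)/g\mid g\in F^*\}$ there is $\rho\in K^*$ with $\rho^m=1$ and $a\rho\in\{\sigma(g)/g\mid g\in F^*\}$. For $\alpha_1,\dots,\alpha_r\in F^*$ let $M((\alpha_1,\dots,\alpha_r),F)=\{(n_1,\dots,n_r)\in\mathbb Z^r\mid\exists g\in F^*:\ \alpha_1^{n_1}\cdots\alpha_r^{n_r}=\sigma(g)/g\}$. **Theorem.** Let $(F,\sigma)$ be a radical-stable difference field with $K=\mathrm{const}(F,\sigma)$ and let $\bar\tau:F\to S(K)$ be a $K$-embedding. Let $(F\langle x_1\rangle\dots\langle x_r\rangle,\sigma)$ be a $P$-extension of $(F,\sigma)$ with $\alpha_i=\sigma(x_i)/x_i\in F^*$ and let $\tau:F\langle x_1\rangle\dots\langle x_r\rangle\to S(K)$ be a $K$-homomorphism with $\tau|_F=\bar\tau$. Suppose that $(d_1,0,\dots,0),(0,d_2,0,\dots,0),\dots,(0,\dots,0,d_u,0,\dots,0)$, with $1\le u\le r$ and non-negative integers $d_1\mid\dots\mid d_u$, is a $\mathbb Z$-basis of $M((\alpha_1,\dots,\alpha_r),F)$.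 Put $E=F\langle x_{u+1}\rangle\dots\langle x_r\rangle$. (1) $(E,\sigma)$ is a $\Pi$-extension of $(F,\sigma)$ and $\tau|_E$ is a $K$-embedding. (2a) If $d_u=1$, there are $\bar g_i\in F^*$ with $\sigma(\bar g_i)=\alpha_i\bar g_i$ and $c_i\in K^*$ $(1\le i\le u)$, and a surjective difference ring homomorphism $\lambda:F\langle x_1\rangle\dots\langle x_r\rangle\to E$ with $\lambda|_E=\mathrm{id}$ and $\lambda(x_i)=c_i\bar g_i$ for $1\le i\le u$, such that $\tau|_E(\lambda(f))=\tau(f)$ for all $f$. (2b) Otherwise $d_u>1$, and there are an $R$-extension $(E[z],\sigma)$ of $(E,\sigma)$ of order $d_u$ with $\rho=\sigma(z)/z\in K^*$, and a $K$-embedding $\tau':E[z]\to S(K)$ with $\tau'|_E=\tau|_E$ and $\tau'(z)=(\rho^k)_{k\ge0}$. Moreover there are $\bar g_i\in F^*$, $\nu_i\in\{0,\dots,d_u-1\}$ with $\sigma(\bar g_i)=\rho^{\nu_i}\alpha_i\bar g_i$, where $z^{\nu_i},z^{d_u-\nu_i},\rho^{\nu_i},\rho^{d_u-\nu_i}$ all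 have multiplicative order $d_i$, and $c_i\in K^*$ $(1\le i\le u)$, and a surjective difference ring homomorphism $\lambda:F\langle x_1\rangle\dots\langle x_r\rangle\to E[z]$ with $\lambda|_E=\mathrm{id}$ and $\lambda(x_i)=c_iz^{d_u-\nu_i}\bar g_i$ for $1\le i\le u$, such that $\tau'(\lambda(f))=\tau(f)$ for all $f$. (3) In both cases $\ker\tau=\ker\lambda=\langle x_1^{d_1}-(c_1\bar g_1)^{d_1},\dots,x_u^{d_u}-(c_u\bar g_u)^{d_u}\rangle$, an ideal of $F\langle x_1\rangle\dots\langle x_r\rangle$. (4) Suppose in addition that $(F,\sigma)$ is computable (elements of $F$ are coded by natural numbers such that $+$, $\cdot$, inversion and $\sigma$ are computable), that $\bar\tau(f)=(\mathrm{ev}(f,n))_{n\ge0}$ for a computable evaluation function $\mathrm{ev}:F\times\mathbb N\to K$ with a computable $o^\sigma$-function $L:F\to\mathbb N$ (i.e. $\mathrm{ev}(f+g,n)=\mathrm{ev}(f,n)+\mathrm{ev}(g,n)$ and $\mathrm{ev}(fg,n)=\mathrm{ev}(f,n)\mathrm{ev}(g,n)$ for $n\ge\max(L(f),L(g))$, and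 $\mathrm{ev}(\sigma^l(f),n)=\mathrm{ev}(f,n+l)$ for $l\in\mathbb Z$, $n\ge L(f)+\max(0,-l)$) and a computable $Z:F\to\mathbb N$ with $\mathrm{ev}(f,n)\ne0$ for $f\ne0$, $n\ge Z(f)$, and that one can solve first-order homogeneous equations in $(F,\sigma)$ (an algorithm finds, given $w\in F^*$, some $g\in F^*$ with $\sigma(g)=wg$ whenever one exists). Then there is one algorithm that, for every extension as above, computes from $\alpha_1,\dots,\alpha_r$, $d_1,\dots,d_u$ and any $\kappa_i\in K$, $l_i\in\mathbb N$ with $\tau(x_i)=\big(\kappa_i\prod_{l_i\le k<n}\mathrm{ev}(\alpha_i,k)\big)_{n\ge0}$ elements $\rho,\nu_i,\bar g_i,c_i$ (in case $d_u=1$: $\bar g_i,c_i$) as in (2a), (2b), (3); in particular it yields the generators of $\ker\lambda=\ker\tau$. Moreover $(E,\sigma)$, resp. $(E[z],\sigma)$, is a computable difference ring with decidable equality and $\lambda$ is computable, where ring elements are given as lists of terms. -/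

import Mathlib

open Filter

universe v w

/-! ### Difference rings, constants, sequences -/

/-- The constant field `const(F, σ) = {c ∈ F | σ c = c}` of a difference field `(F, σ)`. -/
def constField {F : Type*} [Field F] (σ : F ≃+* F) : Subfield F :=
  (σ : F →+* F).eqLocusField (RingHom.id F)

/-- The ring of sequences with entries in `K`: elements of `K^ℕ`, where two sequences are
identified if they agree from some point on. -/
abbrev SeqRing (K : Type*) [Field K] : Type _ := Germ (atTop : Filter ℕ) K

/-- The class of a sequence in the ring of sequences. -/
abbrev toSeq {K : Type*} [Field K] (f : ℕ → K) : SeqRing K := (f : Germ (atTop : Filter ℕ) K)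

theorem tendsto_pred_atTop : Tendsto (fun n : ℕ => n - 1) atTop atTop :=
  tendsto_sub_atTop_nat 1

/-- The shift automorphism `S (a₀, a₁, a₂, …) = (a₁, a₂, …)` of the ring of sequences. -/
def seqShift (K : Type*) [Field K] : SeqRing K ≃+* SeqRing K where
  toFun f := f.compTendsto (fun n : ℕ => n + 1) (tendsto_add_atTop_nat 1)
  invFun f := f.compTendsto (fun n : ℕ => n - 1) tendsto_pred_atTop
  left_inv f := by
    induction f using Germ.inductionOn with
    | _ f =>
      refine Germ.coe_eq.2 ?_
      filter_upwards [eventually_ge_atTop 1] with n hn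
      simp [Nat.sub_add_cancel hn]
  right_inv f := by
    induction f using Germ.inductionOn with
    | _ f =>
      refine Germ.coe_eq.2 (Eventually.of_forall fun n => ?_)
      simp
  map_mul' f g := by
    induction f, g using Germ.inductionOn₂ with
    | _ f g => rfl
  map_add' f g := by
    induction f, g using Germ.inductionOn₂ with
    | _ f g => rfl

theorem seqShift_toSeq {K : Type*} [Field K] (f : ℕ → K) :
    seqShift K (toSeq f) = toSeq (fun n => f (n + 1)) := rfl

/-- `f` is a difference ring homomorphism `(A, σA) → (B, σB)`. -/
def IsDiffHom {A B : Type*} [CommRing A] [CommRing B] (σA : A ≃+* A) (σB : B ≃+* B)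
    (f : A →+* B) : Prop :=
  ∀ a, f (σA a) = σB (f a)

/-- `K`-homomorphisms `τ : (A, σA) → (S(K), S)`: difference ring homomorphisms with
`τ c = (c, c, c, …)` for `c ∈ K`; the inclusion of `K` in `A` is the map `incl`. -/
structure IsKHom {K A : Type*} [Field K] [CommRing A] (σA : A ≃+* A) (incl : K →+* A)
    (τ : A →+* SeqRing K) : Prop where
  diffHom : IsDiffHom σA (seqShift K) τ
  const : ∀ c : K, τ (incl c) = toSeq fun _ => c

/-- `K`-embeddings are the injective `K`-homomorphisms. -/
structure IsKEmbedding {K A : Type*} [Field K] [CommRing A] (σA : A ≃+* A) (incl : K →+* A)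
    (τ : A →+* SeqRing K) : Prop extends IsKHom σA incl τ where
  injective : Function.Injective τ

/-- The constants of `(B, σB)` are those of `(A, σA)`. -/
def NoNewConstants {A B : Type*} [CommRing A] [CommRing B] [Algebra A B] (σA : A ≃+* A)
    (σB : B ≃+* B) : Prop :=
  ∀ b, σB b = b → ∃ a, σA a = a ∧ algebraMap A B a = b

/-! ### `P`-, `Π`-, `A`- and `R`-extensions -/

/-- The Laurent monomial `∏ xᵢ ^ mᵢ`. -/
def laurentMonomial {B : Type*} [CommRing B] {k : ℕ} (x : Fin k → Bˣ) (m : Fin k → ℤ) : B :=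
  ((∏ i, x i ^ m i : Bˣ) : B)

/-- `(B, σB)` is a `P`-extension of `(A, σA)` with `B = A⟨x₁⟩…⟨x_k⟩`, the ring of Laurent
polynomials in `x₁, …, x_k` (the Laurent monomials form an `A`-basis of `B`), and
`σB xᵢ = αᵢ xᵢ` with `αᵢ ∈ A^*`. -/
structure IsPExtension {A B : Type*} [CommRing A] [CommRing B] [Algebra A B] (σA : A ≃+* A)
    (σB : B ≃+* B) {k : ℕ} (x : Fin k → Bˣ) (α : Fin k → Aˣ) : Prop where
  extends_aut : ∀ a, σB (algebraMap A B a) = algebraMap A B (σA a)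
  linearIndependent : LinearIndependent A (laurentMonomial x)
  span_eq_top : Submodule.span A (Set.range (laurentMonomial x)) = ⊤
  shift_gen : ∀ i, σB (x i) = algebraMap A B (α i) * x i

/-- A `Π`-extension is a `P`-extension without new constants. -/
structure IsPiExtension {A B : Type*} [CommRing A] [CommRing B] [Algebra A B] (σA : A ≃+* A)
    (σB : B ≃+* B) {k : ℕ} (x : Fin k → Bˣ) (α : Fin k → Aˣ) : Prop
    extends IsPExtension σA σB x α where
  noNewConstants : NoNewConstants (B := B) σA σB

/-- `(B, σB)` is an `A`-extension of `(A, σA)` of order `n > 1` with `B = A[z]` subject to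
`z ^ n = 1` (so `1, z, …, z ^ (n - 1)` is an `A`-basis of `B`), and `σB z = ρ z` with `ρ ^ n = 1`. -/
structure IsAExtension {A B : Type*} [CommRing A] [CommRing B] [Algebra A B] (σA : A ≃+* A)
    (σB : B ≃+* B) (z : B) (n : ℕ) (ρ : A) : Prop where
  one_lt : 1 < n
  extends_aut : ∀ a, σB (algebraMap A B a) = algebraMap A B (σA a)
  pow_eq_one : z ^ n = 1
  linearIndependent : LinearIndependent A (fun i : Fin n => z ^ (i : ℕ))
  span_eq_top : Submodule.span A (Set.range fun i : Fin n => z ^ (i : ℕ)) = ⊤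
  root_pow : ρ ^ n = 1
  shift_gen : σB z = algebraMap A B ρ * z

/-- An `R`-extension is an `A`-extension without new constants. -/
structure IsRExtension {A B : Type*} [CommRing A] [CommRing B] [Algebra A B] (σA : A ≃+* A)
    (σB : B ≃+* B) (z : B) (n : ℕ) (ρ : A) : Prop extends IsAExtension σA σB z n ρ where
  noNewConstants : NoNewConstants (B := B) σA σB

/-! ### Radical stability and the module `M` -/

/-- The homogeneous group `H_(F,σ) = {σ(g)/g | g ∈ F^*}`, as a subset of `F`. -/
def homogeneousGroup {F : Type*} [Field F] (σ : F ≃+* F) : Set F :=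
  {a | ∃ g : F, g ≠ 0 ∧ a = σ g / g}

/-- `(F, σ)` is radical-stable. -/
def RadicalStable {F : Type*} [Field F] (σ : F ≃+* F) : Prop :=
  ∀ (a : F) (m : ℕ), a ≠ 0 → 0 < m → a ^ m ∈ homogeneousGroup σ →
    ∃ ρ ∈ constField σ, ρ ^ m = 1 ∧ a * ρ ∈ homogeneousGroup σ

/-- The `ℤ`-module `M((α₁, …, α_r), F) ⊆ ℤ^r` of all `n` with `∏ αᵢ ^ nᵢ = σ(g)/g` for some
`g ∈ F^*`. -/
def relModule {F : Type*} [Field F] (σ : F ≃+* F) {r : ℕ} (α : Fin r → Fˣ) :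
    Submodule ℤ (Fin r → ℤ) :=
  AddSubgroup.toIntSubmodule
    { carrier := {n | ∏ i, (α i : F) ^ n i ∈ homogeneousGroup σ}
      zero_mem' := ⟨1, one_ne_zero, by simp⟩
      add_mem' := by
        rintro a b ⟨g, hg, h⟩ ⟨g', hg', h'⟩
        refine ⟨g * g', mul_ne_zero hg hg', ?_⟩
        simp only [Pi.add_apply]
        rw [Finset.prod_congr rfl fun i _ => zpow_add₀ (α i).ne_zero (a i) (b i),
          Finset.prod_mul_distrib, h, h', map_mul, div_mul_div_comm]
      neg_mem' := by
        rintro a ⟨g, hg, h⟩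
        refine ⟨g⁻¹, inv_ne_zero hg, ?_⟩
        simp only [Pi.neg_apply, zpow_neg, Finset.prod_inv_distrib]
        rw [h, map_inv₀, inv_div, inv_div_inv] }

/-! ### The situation of the theorem

The generators are `x₁, …, x_r` with `r = u + s`: the first `u` of them are the
`x (Fin.castAdd s i)`, and the remaining ones, `x_{u+1}, …, x_r`, are the `x (Fin.natAdd u j)`. -/

section Situation

variable {F : Type*} [Field F] {H : Type*} [CommRing H] [Algebra F H] {u s : ℕ}

/-- The inclusion of `K = const(F, σ)` in an `F`-algebra. -/
def constIncl (σ : F ≃+* F) (A : Type*) [CommRing A] [Algebra F A] : constField σ →+* A :=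
  (algebraMap F A).comp (constField σ).subtype

/-- `(H, σH)` is a `P`-extension `F⟨x₁⟩…⟨x_r⟩` of `(F, σ)` with `αᵢ = σ(xᵢ)/xᵢ ∈ F^*`,
`τ : H → S(K)` is a `K`-homomorphism extending `τF`, and
`(d₁,0,…,0), (0,d₂,0,…,0), …, (0,…,0,d_u,0,…,0)` with `d₁ ∣ ⋯ ∣ d_u` is a basis of the
`ℤ`-module `M((α₁,…,α_r), F)`. -/
structure SpecialCase (σ : F ≃+* F) (τF : F →+* SeqRing (constField σ)) (σH : H ≃+* H)
    (x : Fin (u + s) → Hˣ) (α : Fin (u + s) → Fˣ) (τ : H →+* SeqRing (constField σ))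
    (d : Fin u → ℕ) : Prop where
  isPExtension : IsPExtension σ σH x α
  isKHom : IsKHom σH (constIncl σ H) τ
  restrict : ∀ a, τ (algebraMap F H a) = τF a
  dvd : ∀ i j, i ≤ j → d i ∣ d j
  basis_linearIndependent :
    LinearIndependent ℤ fun i : Fin u => (Pi.single (Fin.castAdd s i) (d i : ℤ) : Fin (u + s) → ℤ)
  basis_span :
    Submodule.span ℤ (Set.range fun i : Fin u =>
      (Pi.single (Fin.castAdd s i) (d i : ℤ) : Fin (u + s) → ℤ)) = relModule σ α

/-- `d_u`, the last entry of `(d₁, …, d_u)`. -/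
def lastEntry (hu : 0 < u) (d : Fin u → ℕ) : ℕ := d ⟨u - 1, Nat.sub_one_lt_of_lt hu⟩

variable (F) in
/-- The subring `F⟨x_{u+1}⟩…⟨x_r⟩` of `F⟨x₁⟩…⟨x_r⟩`. -/
def tailRing (x : Fin (u + s) → Hˣ) : Subalgebra F H :=
  Algebra.adjoin F (⋃ j : Fin s,
    {(x (Fin.natAdd u j) : H), (((x (Fin.natAdd u j))⁻¹ : Hˣ) : H)})

variable (F) in
/-- `x_{u+1}, …, x_r` as units of `F⟨x_{u+1}⟩…⟨x_r⟩`. -/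
def tailGen (x : Fin (u + s) → Hˣ) (j : Fin s) : (tailRing F x)ˣ where
  val := ⟨x (Fin.natAdd u j), Algebra.subset_adjoin (Set.mem_iUnion.2 ⟨j, by simp⟩)⟩
  inv := ⟨((x (Fin.natAdd u j))⁻¹ : Hˣ), Algebra.subset_adjoin (Set.mem_iUnion.2 ⟨j, by simp⟩)⟩
  val_inv := Subtype.ext (by simp)
  inv_val := Subtype.ext (by simp)

/-- The restriction of `τ` to `F⟨x_{u+1}⟩…⟨x_r⟩`. -/
def tailTau {S : Type*} [CommRing S] (x : Fin (u + s) → Hˣ) (τ : H →+* S) :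
    tailRing F x →+* S :=
  τ.comp (tailRing F x).val.toRingHom

/-- The ideal `⟨x₁^{d₁} - (c₁ḡ₁)^{d₁}, …, x_u^{d_u} - (c_uḡ_u)^{d_u}⟩` of `F⟨x₁⟩…⟨x_r⟩`. -/
def relIdeal {σ : F ≃+* F} (x : Fin (u + s) → Hˣ) (d : Fin u → ℕ) (g : Fin u → Fˣ)
    (c : Fin u → constField σ) : Ideal H :=
  Ideal.span (Set.range fun i : Fin u =>
    (x (Fin.castAdd s i) : H) ^ d i - algebraMap F H ((c i : F) * g i) ^ d i)

/-- Part (1): with `E = F⟨x_{u+1}⟩…⟨x_r⟩` and `σE` the restriction of `σH` to `E`, `(E, σE)` is a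
`Π`-extension of `(F, σ)` and `τ|_E` is a `K`-embedding. -/
structure TailStatement (σ : F ≃+* F) (σH : H ≃+* H) (x : Fin (u + s) → Hˣ)
    (α : Fin (u + s) → Fˣ) (τ : H →+* SeqRing (constField σ))
    (σE : tailRing F x ≃+* tailRing F x) : Prop where
  restrict_aut : ∀ e, (σE e : H) = σH e
  isPiExtension : IsPiExtension σ σE (tailGen F x) fun j => α (Fin.natAdd u j)
  isKEmbedding : IsKEmbedding σE (constIncl σ (tailRing F x)) (tailTau x τ)

/-- Parts (2a) and (3), the case `d_u = 1`, for given `ḡᵢ ∈ F^*`, `cᵢ ∈ K^*` and `lam = λ`. -/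
structure PiFactorization (σ : F ≃+* F) (σH : H ≃+* H) (x : Fin (u + s) → Hˣ)
    (α : Fin (u + s) → Fˣ) (τ : H →+* SeqRing (constField σ)) (d : Fin u → ℕ)
    (σE : tailRing F x ≃+* tailRing F x) (g : Fin u → Fˣ) (c : Fin u → constField σ)
    (lam : H →+* tailRing F x) : Prop where
  shift_g : ∀ i, σ (g i) = α (Fin.castAdd s i) * g i
  c_ne_zero : ∀ i, c i ≠ 0
  lam_diffHom : IsDiffHom σH σE lam
  lam_surjective : Function.Surjective lam
  lam_tail : ∀ e : tailRing F x, lam e = e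
  lam_gen : ∀ i, lam (x (Fin.castAdd s i)) = algebraMap F (tailRing F x) (c i * g i)
  tau_lam : ∀ f, tailTau x τ (lam f) = τ f
  ker_tau : RingHom.ker τ = RingHom.ker lam
  ker_lam : RingHom.ker lam = relIdeal x d g c

/-- Parts (2b) and (3), the case `n = d_u > 1`, for given `ρ ∈ K`, `νᵢ ∈ ℕ`, `ḡᵢ ∈ F^*`,
`cᵢ ∈ K^*`, a difference ring `(B, σB)` with `B = E[z]`, and maps `τ' : E[z] → S(K)`,
`lam = λ : F⟨x₁⟩…⟨x_r⟩ → E[z]`. -/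
structure RFactorization (σ : F ≃+* F) (σH : H ≃+* H) (x : Fin (u + s) → Hˣ)
    (α : Fin (u + s) → Fˣ) (τ : H →+* SeqRing (constField σ)) (d : Fin u → ℕ) (n : ℕ)
    (σE : tailRing F x ≃+* tailRing F x) (ρ : constField σ) (ν : Fin u → ℕ) (g : Fin u → Fˣ)
    (c : Fin u → constField σ) {B : Type*} [CommRing B] [Algebra (tailRing F x) B]
    (σB : B ≃+* B) (z : B) (τ' : B →+* SeqRing (constField σ)) (lam : H →+* B) : Prop where
  isRExtension : IsRExtension σE σB z n (constIncl σ (tailRing F x) ρ)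
  tau'_isKEmbedding :
    IsKEmbedding σB ((algebraMap (tailRing F x) B).comp (constIncl σ (tailRing F x))) τ'
  tau'_tail : ∀ e, τ' (algebraMap (tailRing F x) B e) = tailTau x τ e
  tau'_z : τ' z = toSeq fun k => ρ ^ k
  nu_lt : ∀ i, ν i < n
  shift_g : ∀ i, σ (g i) = (ρ : F) ^ ν i * α (Fin.castAdd s i) * g i
  order_z : ∀ i, orderOf (z ^ ν i) = d i ∧ orderOf (z ^ (n - ν i)) = d i
  order_rho : ∀ i, orderOf (ρ ^ ν i) = d i ∧ orderOf (ρ ^ (n - ν i)) = d i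
  c_ne_zero : ∀ i, c i ≠ 0
  lam_diffHom : IsDiffHom σH σB lam
  lam_surjective : Function.Surjective lam
  lam_tail : ∀ e : tailRing F x, lam e = algebraMap (tailRing F x) B e
  lam_gen : ∀ i, lam (x (Fin.castAdd s i)) =
    algebraMap (tailRing F x) B (algebraMap F (tailRing F x) (c i)) * z ^ (n - ν i) *
      algebraMap (tailRing F x) B (algebraMap F (tailRing F x) (g i))
  tau_lam : ∀ f, τ' (lam f) = τ f
  ker_tau : RingHom.ker τ = RingHom.ker lam
  ker_lam : RingHom.ker lam = relIdeal x d g c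

end Situation

/-! ### Algorithmic notions

Elements of a computable field are given by a coding (`Primcodable`; in particular equality is
decidable); elements of the extensions are given by lists of terms. -/

section Algorithmic

variable {F : Type*} [Field F]

/-- `(F, σ)` is computable. -/
structure IsComputableDiffField [Primcodable F] (σ : F ≃+* F) : Prop where
  add : Computable₂ fun a b : F => a + b
  mul : Computable₂ fun a b : F => a * b
  inv : Computable fun a : F => a⁻¹
  aut : Computable fun a : F => σ a

/-- `ev` is an evaluation function for the difference field `(F, σ)`. -/
structure IsEvaluation (σ : F ≃+* F) (ev : F → ℕ → constField σ) : Prop where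
  const : ∀ c : constField σ, ∀ᶠ n in atTop, ev c n = c
  add : ∀ f g, ∀ᶠ n in atTop, ev (f + g) n = ev f n + ev g n
  mul : ∀ f g, ∀ᶠ n in atTop, ev (f * g) n = ev f n * ev g n
  shift : ∀ (f : F) (l : ℤ), ∀ᶠ n : ℕ in atTop,
    ev ((σ ^ l : RingAut F) f) n = ev f ((n : ℤ) + l).toNat

/-- `L` is an `o^σ`-function for `ev`. Under the bound in `shift` one has `n + l ≥ 0`. -/
structure IsOSigmaFunction (σ : F ≃+* F) (ev : F → ℕ → constField σ) (L : F → ℕ) : Prop where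
  add : ∀ f g n, max (L f) (L g) ≤ n → ev (f + g) n = ev f n + ev g n
  mul : ∀ f g n, max (L f) (L g) ≤ n → ev (f * g) n = ev f n * ev g n
  shift : ∀ (f : F) (l : ℤ) (n : ℕ), (L f : ℤ) + max 0 (-l) ≤ n →
    ev ((σ ^ l : RingAut F) f) n = ev f ((n : ℤ) + l).toNat

/-- `Z` is a `z`-function for `ev`. -/
def IsZFunction (σ : F ≃+* F) (ev : F → ℕ → constField σ) (Z : F → ℕ) : Prop :=
  ∀ f, f ≠ 0 → ∀ n, Z f ≤ n → ev f n ≠ 0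

/-- `τF` is `o^σ`-computable by means of the computable evaluation function `ev` with the
computable `o^σ`-function `L`, and `Z` is a computable `z`-function. -/
structure IsOSigmaComputable [Primcodable F] (σ : F ≃+* F) (τF : F →+* SeqRing (constField σ))
    (ev : F → ℕ → constField σ) (L Z : F → ℕ) : Prop where
  isEvaluation : IsEvaluation σ ev
  isOSigmaFunction : IsOSigmaFunction σ ev L
  isZFunction : IsZFunction σ ev Z
  computable_ev : Computable₂ fun (f : F) (n : ℕ) => (ev f n : F)
  computable_L : Computable L
  computable_Z : Computable Z
  tau_eq : ∀ f, τF f = toSeq (ev f)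

/-- One can solve first-order homogeneous difference equations in `(F, σ)`: some algorithm finds,
for `w ∈ F^*`, a `g ∈ F^*` with `σ g = w g` whenever there is one. -/
def CanSolveHomogeneous [Primcodable F] (σ : F ≃+* F) : Prop :=
  ∃ solve : F →. F, Partrec solve ∧
    ∀ w : F, w ≠ 0 → (∃ g : F, g ≠ 0 ∧ σ g = w * g) → ∃ g ∈ solve w, g ≠ 0 ∧ σ g = w * g

/-- `φ` is computable when the elements of `A`, `B` are given by codes via `repA`, `repB`. -/
def ComputableVia {C D A B : Type*} [Primcodable C] [Primcodable D] (repA : C → A) (repB : D → B)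
    (φ : A → B) : Prop :=
  ∃ f : C → D, Computable f ∧ ∀ a, φ (repA a) = repB (f a)

/-- `(A, σA)` is a computable difference ring via the representation `rep` of its elements. -/
structure IsComputableDiffRing {C A : Type*} [Primcodable C] [CommRing A] (rep : C → A)
    (σA : A ≃+* A) : Prop where
  surjective : Function.Surjective rep
  eq : ComputablePred fun p : C × C => rep p.1 = rep p.2
  add : ∃ f : C → C → C, Computable₂ f ∧ ∀ a b, rep (f a b) = rep a + rep b
  mul : ∃ f : C → C → C, Computable₂ f ∧ ∀ a b, rep (f a b) = rep a * rep b
  aut : ComputableVia rep rep σA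

/-- The element `∑ a x₁^{m₁}⋯x_k^{m_k}` given by a list of terms `(a, m)`. -/
def laurentRep {A : Type*} [CommRing A] [Algebra F A] {k : ℕ} (x : Fin k → Aˣ)
    (t : List (F × (Fin k → ℤ))) : A :=
  (t.map fun p => algebraMap F A p.1 * laurentMonomial x p.2).sum

/-- The element `∑ a x₁^{m₁}⋯x_k^{m_k} z^e` of `E[z]` given by a list of terms `(a, m, e)`. -/
def laurentRootRep {E B : Type*} [CommRing E] [Algebra F E] [CommRing B] [Algebra E B] {k : ℕ}
    (x : Fin k → Eˣ) (z : B) (t : List (F × (Fin k → ℤ) × ℕ)) : B :=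
  (t.map fun p => algebraMap E B (algebraMap F E p.1 * laurentMonomial x p.2.1) * z ^ p.2.2).sum

end Algorithmic

/-! ### Computable functions on lists, predicates and integers -/

section ComputabilityToolkit

variable {α β γ : Type*} [Primcodable α] [Primcodable β] [Primcodable γ]

theorem Computable.list_foldl {f : α → List β} {g : α → γ} {h : α → γ × β → γ}
    (hf : Computable f) (hg : Computable g) (hh : Computable₂ h) :
    Computable fun a => (f a).foldl (fun s b => h a (s, b)) (g a) := by
  have hstep : Computable₂ fun (a : α) (p : ℕ × γ) =>
      Option.casesOn (motive := fun _ => γ) ((f a)[p.1]?) p.2 (fun b => h a (p.2, b)) :=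
    Computable.option_casesOn
      (Computable.list_getElem?.comp (hf.comp .fst) (Computable.fst.comp .snd))
      (Computable.snd.comp .snd)
      (hh.comp (Computable.fst.comp .fst)
        ((Computable.snd.comp (Computable.snd.comp .fst)).pair .snd)).to₂
  refine (Computable.nat_rec (Computable.list_length.comp hf) hg hstep).of_eq fun a => ?_
  have key : ∀ k, k ≤ (f a).length →
      Nat.rec (motive := fun _ => γ) (g a) (fun y IH =>
        Option.casesOn (motive := fun _ => γ) ((f a)[y]?) IH (fun b => h a (IH, b))) k =
      ((f a).take k).foldl (fun s b => h a (s, b)) (g a) := by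
    intro k
    induction k with
    | zero => simp
    | succ k ih =>
      intro hk
      have hk' : k < (f a).length := hk
      simp only [List.take_add_one, List.foldl_append, ih hk'.le, List.getElem?_eq_getElem hk',
        Option.toList_some, List.foldl_cons, List.foldl_nil]
  simpa using key _ le_rfl

theorem Computable.list_flatMap {f : α → List β} {g : α → β → List γ} (hf : Computable f)
    (hg : Computable₂ g) : Computable fun a => (f a).flatMap (g a) := by
  refine (Computable.list_foldl (h := fun a p => p.1 ++ g a p.2) hf (Computable.const [])
    (Computable.list_append.comp (Computable.fst.comp .snd)
      (hg.comp .fst (Computable.snd.comp .snd)))).of_eq fun a => ?_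
  have key : ∀ (l : List β) (acc : List γ),
      l.foldl (fun s b => s ++ g a b) acc = acc ++ l.flatMap (g a) := by
    intro l
    induction l with
    | nil => simp
    | cons b l ih => intro acc; simp [ih]
  simpa using key (f a) []

theorem Computable.list_map {f : α → List β} {g : α → β → γ} (hf : Computable f)
    (hg : Computable₂ g) : Computable fun a => (f a).map (g a) :=
  (Computable.list_flatMap (g := fun a b => [g a b]) hf
    (Computable.list_cons.comp hg (Computable.const []))).of_eq fun a => by
      induction f a <;> simp_all

theorem Computable.list_sum [AddCommMonoid γ] (hadd : Computable₂ fun a b : γ => a + b)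
    {f : α → List γ} (hf : Computable f) : Computable fun a => (f a).sum := by
  refine (Computable.list_foldl (h := fun _ p => p.1 + p.2) hf (Computable.const 0)
    (hadd.comp (Computable.fst.comp .snd) (Computable.snd.comp .snd))).of_eq fun a => ?_
  exact List.sum_eq_foldl.symm

theorem Computable.prod_range [CommMonoid γ] (hmul : Computable₂ fun a b : γ => a * b)
    {n : α → ℕ} {f : α → ℕ → γ} (hn : Computable n) (hf : Computable₂ f) :
    Computable fun a => ∏ k ∈ Finset.range (n a), f a k := by
  refine (Computable.nat_rec (h := fun a p => p.2 * f a p.1) hn (Computable.const 1)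
    (hmul.comp (Computable.snd.comp .snd)
      (hf.comp .fst (Computable.fst.comp .snd)))).of_eq fun a => ?_
  induction n a with
  | zero => simp
  | succ k ih => rw [Finset.prod_range_succ, ← ih]

theorem Computable.pow_of_mul [CommMonoid γ] (hmul : Computable₂ fun a b : γ => a * b)
    {f : α → γ} {n : α → ℕ} (hf : Computable f) (hn : Computable n) :
    Computable fun a => f a ^ n a :=
  (Computable.prod_range hmul hn (hf.comp .fst).to₂).of_eq fun a => by simp

theorem Computable.prod_finset [CommMonoid γ] (hmul : Computable₂ fun a b : γ => a * b)
    {ι : Type*} (t : Finset ι) {f : ι → α → γ} (hf : ∀ i, Computable (f i)) :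
    Computable fun a => ∏ i ∈ t, f i a := by
  classical
  induction t using Finset.induction_on with
  | empty => simpa using Computable.const 1
  | insert i t hi ih => simpa [Finset.prod_insert hi] using hmul.comp (hf i) ih

theorem Computable.sum_finset_nat {ι : Type*} (t : Finset ι) {f : ι → α → ℕ}
    (hf : ∀ i, Computable (f i)) : Computable fun a => ∑ i ∈ t, f i a := by
  classical
  induction t using Finset.induction_on with
  | empty => simpa using Computable.const 0
  | insert i t hi ih =>
    simpa [Finset.sum_insert hi] using Primrec.nat_add.to_comp.comp (hf i) ih

theorem Computable.ite_of_pred {p : α → Prop} [DecidablePred p] (hp : ComputablePred p)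
    {f g : α → γ} (hf : Computable f) (hg : Computable g) :
    Computable fun a => if p a then f a else g a :=
  (Computable.cond hp.decide hf hg).of_eq fun a => by by_cases h : p a <;> simp [h]

theorem ComputablePred.comp_computable {p : β → Prop} (hp : ComputablePred p) {f : α → β}
    (hf : Computable f) : ComputablePred fun a => p (f a) := by
  classical
  exact (hp.decide.comp hf).computablePred

theorem ComputablePred.and_pred {p q : α → Prop} (hp : ComputablePred p) (hq : ComputablePred q) :
    ComputablePred fun a => p a ∧ q a := by
  classical
  exact ((Primrec.and.to_comp.comp hp.decide hq.decide).of_eq fun a => by simp).computablePred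

theorem ComputablePred.eq_apply {f g : α → β} (hf : Computable f) (hg : Computable g) :
    ComputablePred fun a => f a = g a :=
  ComputablePred.comp_computable (p := fun q : β × β => q.1 = q.2)
    (PrimrecPred.computablePred Primrec.eq) (hf.pair hg)

theorem ComputablePred.ne_apply {f g : α → β} (hf : Computable f) (hg : Computable g) :
    ComputablePred fun a => f a ≠ g a := (ComputablePred.eq_apply hf hg).not

theorem ComputablePred.le_apply {f g : α → ℕ} (hf : Computable f) (hg : Computable g) :
    ComputablePred fun a => f a ≤ g a :=
  ComputablePred.comp_computable (p := fun q : ℕ × ℕ => q.1 ≤ q.2)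
    (PrimrecPred.computablePred Primrec.nat_le) (hf.pair hg)

theorem ComputablePred.lt_apply {f g : α → ℕ} (hf : Computable f) (hg : Computable g) :
    ComputablePred fun a => f a < g a :=
  ComputablePred.le_apply (Computable.succ.comp hf) hg

theorem ComputablePred.forall_mem_list {f : α → List β} {p : α → β → Prop} (hf : Computable f)
    (hp : ComputablePred fun q : α × β => p q.1 q.2) :
    ComputablePred fun a => ∀ b ∈ f a, p a b := by
  classical
  refine Computable.computablePred ?_
  refine (Computable.list_foldl (h := fun a q => q.1 && decide (p a q.2)) hf (Computable.const true)
    (Primrec.and.to_comp.comp (Computable.fst.comp .snd)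
      (hp.decide.comp (Computable.fst.pair (Computable.snd.comp .snd))))).of_eq fun a => ?_
  have key : ∀ (l : List β) (acc : Bool),
      l.foldl (fun s b => s && decide (p a b)) acc = (acc && decide (∀ b ∈ l, p a b)) := by
    intro l
    induction l with
    | nil => simp
    | cons b l ih => intro acc; simp [ih, Bool.and_assoc]
  simpa using key (f a) true

theorem ComputablePred.forall_lt {n : α → ℕ} {p : α → ℕ → Prop} (hn : Computable n)
    (hp : ComputablePred fun q : α × ℕ => p q.1 q.2) :
    ComputablePred fun a => ∀ k < n a, p a k :=
  (ComputablePred.forall_mem_list (Primrec.list_range.to_comp.comp hn) hp).of_eq fun a => by simp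

/-- A decidable relation between inputs and outputs is uniformized by unbounded search. -/
theorem Partrec.exists_uniformization {R : α → β → Prop}
    (hR : ComputablePred fun q : α × β => R q.1 q.2) :
    ∃ f : α →. β, Partrec f ∧ ∀ a, (∃ b, R a b) → ∃ b ∈ f a, R a b := by
  classical
  have hc : Computable₂ fun (a : α) (b : β) => if R a b then some b else Option.none :=
    Computable.ite_of_pred (p := fun q : α × β => R q.1 q.2) hR
      (Computable.option_some.comp .snd) (Computable.const Option.none)
  refine ⟨_, Partrec.rfindOpt (Computable.bind_decode_iff.2 hc), fun a ⟨b, hb⟩ => ?_⟩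
  have hdom := Nat.rfindOpt_dom (f := fun n => (Encodable.decode (α := β) n).bind
    fun b => if R a b then some b else Option.none) |>.2 ⟨Encodable.encode b, b, by simp [hb]⟩
  refine ⟨_, Part.get_mem hdom, ?_⟩
  obtain ⟨n, hn⟩ := Nat.rfindOpt_spec (Part.get_mem hdom)
  simp only [Option.mem_def, Option.bind_eq_some_iff, Option.ite_none_right_eq_some,
    Option.some.injEq] at hn
  obtain ⟨b', -, h, h'⟩ := hn
  rwa [← h']

theorem Primrec.int_ofNat : Primrec fun n : ℕ => (n : ℤ) :=
  Primrec.encode_iff.1 (Primrec.nat_double.of_eq fun _ => rfl)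

theorem Primrec.int_negSucc : Primrec Int.negSucc :=
  Primrec.encode_iff.1 (Primrec.nat_double_succ.of_eq fun _ => rfl)

theorem Primrec.int_toNat : Primrec Int.toNat := by
  refine ((Primrec.cond (Primrec.nat_bodd.comp Primrec.encode) (Primrec.const 0)
    (Primrec.nat_div2.comp Primrec.encode)) : Primrec fun z : ℤ =>
      _root_.cond (Encodable.encode z).bodd 0 (Encodable.encode z).div2).of_eq fun z => ?_
  rcases z with n | n
  · change _root_.cond (Nat.bodd (2 * n)) 0 (Nat.div2 (2 * n)) = n
    simp [Nat.div2_val]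
  · change _root_.cond (Nat.bodd (2 * n + 1)) 0 (Nat.div2 (2 * n + 1)) = 0
    simp

theorem Primrec.int_toNat_neg : Primrec fun z : ℤ => (-z).toNat := by
  refine ((Primrec.cond (Primrec.nat_bodd.comp Primrec.encode)
    (Primrec.succ.comp (Primrec.nat_div2.comp Primrec.encode)) (Primrec.const 0)) :
      Primrec fun z : ℤ =>
      _root_.cond (Encodable.encode z).bodd (Encodable.encode z).div2.succ 0).of_eq fun z => ?_
  rcases z with n | n
  · change _root_.cond (Nat.bodd (2 * n)) (Nat.div2 (2 * n)).succ 0 = _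
    simp
  · change _root_.cond (Nat.bodd (2 * n + 1)) (Nat.div2 (2 * n + 1)).succ 0 = _
    simp [Nat.div2_val]

theorem Primrec.int_subNatNat : Primrec₂ Int.subNatNat := by
  refine (Primrec.nat_casesOn (Primrec.nat_sub.comp Primrec.snd Primrec.fst)
    (Primrec.int_ofNat.comp (Primrec.nat_sub.comp Primrec.fst Primrec.snd))
    (Primrec.int_negSucc.comp Primrec.snd).to₂).of_eq fun p => ?_
  rw [Int.subNatNat]
  cases p.2 - p.1 <;> rfl

theorem Primrec.int_add : Primrec₂ fun a b : ℤ => a + b := by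
  refine (Primrec.int_subNatNat.comp
    (Primrec.nat_add.comp (Primrec.int_toNat.comp Primrec.fst) (Primrec.int_toNat.comp Primrec.snd))
    (Primrec.nat_add.comp (Primrec.int_toNat_neg.comp Primrec.fst)
      (Primrec.int_toNat_neg.comp Primrec.snd))).of_eq fun p => ?_
  rw [Int.subNatNat_eq_coe]
  change _ = p.1 + p.2
  omega

theorem Primrec.int_fun_apply {k : ℕ} (i : Fin k) : Primrec fun m : Fin k → ℤ => m i :=
  Primrec.fin_app.comp Primrec.id (Primrec.const i)

theorem Primrec.int_fun_reindex {k l : ℕ} (e : Fin l → Fin k) :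
    Primrec fun (m : Fin k → ℤ) (j : Fin l) => m (e j) :=
  Primrec.fin_curry.2 (Primrec.fin_app.comp Primrec.fst ((Primrec.dom_finite e).comp Primrec.snd))

theorem Primrec.int_fun_add {k : ℕ} : Primrec₂ fun a b : Fin k → ℤ => a + b := by
  refine (Primrec.fin_curry (f := fun (p : (Fin k → ℤ) × (Fin k → ℤ)) i => p.1 i + p.2 i)).2 ?_
  exact Primrec.int_add.comp
    (Primrec.fin_app.comp (Primrec.fst.comp Primrec.fst) Primrec.snd)
    (Primrec.fin_app.comp (Primrec.snd.comp Primrec.fst) Primrec.snd)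

end ComputabilityToolkit

/-! ### Laurent monomials -/

section LaurentMonomial

variable {A B : Type*} [CommRing A] [CommRing B] {k : ℕ}

theorem map_laurentMonomial (f : A →+* B) (x : Fin k → Aˣ) (m : Fin k → ℤ) :
    f (laurentMonomial x m) = laurentMonomial (fun i => Units.map (f : A →* B) (x i)) m := by
  simp only [laurentMonomial, ← map_zpow, ← map_prod]
  rfl

theorem laurentMonomial_add (x : Fin k → Aˣ) (m m' : Fin k → ℤ) :
    laurentMonomial x m * laurentMonomial x m' = laurentMonomial x (m + m') := by
  simp only [laurentMonomial, ← Units.val_mul, ← Finset.prod_mul_distrib, Pi.add_apply, zpow_add]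

theorem laurentMonomial_zero (x : Fin k → Aˣ) : laurentMonomial x 0 = 1 := by
  simp [laurentMonomial]

theorem laurentMonomial_mul (x y : Fin k → Aˣ) (m : Fin k → ℤ) :
    laurentMonomial (fun i => x i * y i) m = laurentMonomial x m * laurentMonomial y m := by
  simp only [laurentMonomial, ← Units.val_mul, ← Finset.prod_mul_distrib, mul_zpow]

theorem laurentMonomial_single (x : Fin k → Aˣ) (i : Fin k) (z : ℤ) :
    laurentMonomial x (Pi.single i z) = ((x i ^ z : Aˣ) : A) := by
  rw [laurentMonomial, Finset.prod_eq_single i (fun j _ hj => by simp [Pi.single_eq_of_ne hj])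
    (by simp), Pi.single_eq_same]

theorem laurentMonomial_units_eq {F : Type*} [Field F] (w : Fin k → Fˣ) (m : Fin k → ℤ) :
    laurentMonomial w m = ∏ i, (w i : F) ^ m i := by
  simp [laurentMonomial, Units.coe_prod]

theorem laurentMonomial_split {u s : ℕ} (x : Fin (u + s) → Aˣ) (m : Fin (u + s) → ℤ) :
    laurentMonomial x m =
      laurentMonomial (fun i => x (Fin.castAdd s i)) (fun i => m (Fin.castAdd s i)) *
      laurentMonomial (fun j => x (Fin.natAdd u j)) (fun j => m (Fin.natAdd u j)) := by
  simp only [laurentMonomial, ← Units.val_mul, Fin.prod_univ_add]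

theorem aut_laurentMonomial [Algebra A B] (σB : B ≃+* B) {x : Fin k → Bˣ} {α : Fin k → Aˣ}
    (h : ∀ i, σB (x i) = algebraMap A B (α i) * x i) (m : Fin k → ℤ) :
    σB (laurentMonomial x m) = algebraMap A B (laurentMonomial α m) * laurentMonomial x m := by
  have h' : (fun i => Units.map (σB : B →+* B).toMonoidHom (x i)) =
      fun i => Units.map (algebraMap A B).toMonoidHom (α i) * x i := by
    funext i
    ext
    simpa using h i
  rw [map_laurentMonomial (algebraMap A B), ← laurentMonomial_mul]
  refine (map_laurentMonomial (σB : B →+* B) x m).trans ?_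
  exact congrArg (fun y => laurentMonomial y m) h'

end LaurentMonomial

/-! ### Rings of lists of terms -/

section TermLists

variable {F : Type*} [Field F] [Primcodable F] {I I' J : Type*} [Primcodable I] [Primcodable I']
  [Primcodable J] {A B : Type*} [CommRing A] [CommRing B]

/-- The element `∑ a · mon i` given by a list of terms `(a, i)`. -/
def termRep {F I A : Type*} [Field F] [CommRing A] (ι : F →+* A) (mon : I → A)
    (t : List (F × I)) : A :=
  (t.map fun p => ι p.1 * mon p.2).sum

theorem computableVia_termRep {σ : F ≃+* F} (hF : IsComputableDiffField σ) {ιA : F →+* A}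
    {ιB : F →+* B} {mon : I → A} {mon' : I' → B} (θ : F → F) (hθ : Computable θ) (φ : A →+* B)
    (hι : ∀ a, φ (ιA a) = ιB (θ a)) {χ : I → F} (hχ : Computable χ) {p : I → I'}
    (hp : Computable p) (hmon : ∀ i, φ (mon i) = ιB (χ i) * mon' (p i)) :
    ComputableVia (termRep ιA mon) (termRep ιB mon') φ := by
  refine ⟨fun t => t.map fun q => (θ q.1 * χ q.2, p q.2),
    Computable.list_map Computable.id (((hF.mul.comp (hθ.comp (Computable.fst.comp .snd))
      (hχ.comp (Computable.snd.comp .snd))).pair (hp.comp (Computable.snd.comp .snd)))).to₂,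
    fun t => ?_⟩
  simp only [termRep, map_list_sum, List.map_map]
  congr 1
  refine List.map_congr_left fun q _ => ?_
  simp [hι, hmon, mul_assoc]

theorem isComputableDiffRing_termRep {σ : F ≃+* F} (hF : IsComputableDiffField σ) [Algebra F A]
    {mon : I → A} {b : J → A} {r : I → J} (hr : Computable r) (hb : ∀ i, mon i = b (r i))
    (hind : LinearIndependent F b) (hspan : Submodule.span F (Set.range mon) = ⊤)
    {op : I → I → I} (hop : Computable₂ op) (hmul : ∀ i j, mon i * mon j = mon (op i j))
    (σA : A ≃+* A) (hσ : ∀ a, σA (algebraMap F A a) = algebraMap F A (σ a)) {χ : I → F}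
    (hχ : Computable χ) (hmon : ∀ i, σA (mon i) = algebraMap F A (χ i) * mon i) :
    IsComputableDiffRing (termRep (algebraMap F A) mon) σA where
  surjective a := by
    have ha : a ∈ Submodule.span F (Set.range mon) := hspan ▸ Submodule.mem_top
    induction ha using Submodule.span_induction with
    | mem y hy =>
      obtain ⟨i, rfl⟩ := hy
      exact ⟨[(1, i)], by simp [termRep]⟩
    | zero => exact ⟨[], by simp [termRep]⟩
    | add y z _ _ hy hz =>
      obtain ⟨t, rfl⟩ := hy
      obtain ⟨t', rfl⟩ := hz
      exact ⟨t ++ t', by simp [termRep]⟩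
    | smul c y _ hy =>
      obtain ⟨t, rfl⟩ := hy
      refine ⟨t.map fun q => (c * q.1, q.2), ?_⟩
      rw [Algebra.smul_def, termRep, termRep, ← List.sum_map_mul_left, List.map_map]
      congr 1
      exact List.map_congr_left fun q _ => by simp [mul_assoc]
  eq := by
    classical
    let coef : List (F × I) → J → F := fun t j => (t.map fun q => if r q.2 = j then q.1 else 0).sum
    have hcoef : Computable₂ coef :=
      Computable.list_sum hF.add (Computable.list_map .fst
        (Computable.ite_of_pred (p := fun q : (List (F × I) × J) × (F × I) => r q.2.2 = q.1.2)
          (ComputablePred.eq_apply (hr.comp (Computable.snd.comp .snd)) (Computable.snd.comp .fst))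
          (Computable.fst.comp .snd) (Computable.const 0)).to₂)
    let toF : List (F × I) → (J →₀ F) := fun t => (t.map fun q => Finsupp.single (r q.2) q.1).sum
    have htoF : ∀ t j, toF t j = coef t j := by
      intro t j
      induction t with
      | nil => simp [toF, coef]
      | cons q t ih =>
        simp only [toF, coef, List.map_cons, List.sum_cons, Finsupp.add_apply] at ih ⊢
        rw [ih, Finsupp.single_apply]
    have hrep : ∀ t, termRep (algebraMap F A) mon t = Finsupp.linearCombination F b (toF t) := by
      intro t
      induction t with
      | nil => simp [toF, termRep]
      | cons q t ih =>
        simp only [toF, termRep, List.map_cons, List.sum_cons, map_add] at ih ⊢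
        rw [ih, Finsupp.linearCombination_single, hb, Algebra.smul_def]
    have hsupp : ∀ t j, (∀ q ∈ t, r q.2 ≠ j) → coef t j = 0 := by
      intro t j h
      refine List.sum_eq_zero fun y hy => ?_
      obtain ⟨q, hq, rfl⟩ := List.mem_map.1 hy
      exact if_neg (h q hq)
    have hpred : ComputablePred fun p : List (F × I) × List (F × I) =>
        ∀ q ∈ p.1 ++ p.2, coef p.1 (r q.2) = coef p.2 (r q.2) :=
      ComputablePred.forall_mem_list (Computable.list_append.comp .fst .snd)
        (ComputablePred.eq_apply
          (hcoef.comp (Computable.fst.comp .fst) (hr.comp (Computable.snd.comp .snd)))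
          (hcoef.comp (Computable.snd.comp .fst) (hr.comp (Computable.snd.comp .snd))))
    refine hpred.of_eq fun p => ?_
    rw [hrep, hrep]
    refine ⟨fun h => ?_, fun h q _ => ?_⟩
    · congr 1
      ext j
      rw [htoF, htoF]
      by_cases hj : ∃ q ∈ p.1 ++ p.2, r q.2 = j
      · obtain ⟨q, hq, rfl⟩ := hj
        exact h q hq
      · push Not at hj
        rw [hsupp _ _ fun q hq => hj q (List.mem_append_left _ hq),
          hsupp _ _ fun q hq => hj q (List.mem_append_right _ hq)]
    · rw [← htoF, ← htoF, hind h]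
  add := ⟨fun t t' => t ++ t', Computable.list_append, fun t t' => by simp [termRep]⟩
  mul := by
    have hinner : Computable₂ fun (p : (List (F × I) × List (F × I)) × (F × I)) (q : F × I) =>
        (p.2.1 * q.1, op p.2.2 q.2) :=
      (hF.mul.comp (Computable.fst.comp (Computable.snd.comp .fst))
        (Computable.fst.comp .snd)).pair (hop.comp
          (Computable.snd.comp (Computable.snd.comp .fst)) (Computable.snd.comp .snd))
    have houter : Computable₂ fun (p : List (F × I) × List (F × I)) (q : F × I) =>
        p.2.map fun q' => (q.1 * q'.1, op q.2 q'.2) :=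
      Computable.list_map (Computable.snd.comp .fst) hinner
    refine ⟨fun t t' => t.flatMap fun q => t'.map fun q' => (q.1 * q'.1, op q.2 q'.2),
      Computable.list_flatMap .fst houter, fun t t' => ?_⟩
    induction t with
    | nil => simp [termRep]
    | cons q t ih =>
      simp only [termRep, List.flatMap_cons, List.map_append, List.sum_append, List.map_cons,
        List.sum_cons, add_mul] at ih ⊢
      rw [ih]
      congr 1
      rw [← List.sum_map_mul_left, List.map_map]
      congr 1
      refine List.map_congr_left fun q' _ => ?_
      simp only [Function.comp, map_mul, ← hmul]
      ring
  aut := computableVia_termRep hF σ hF.aut (σA : A →+* A) hσ hχ Computable.id hmon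

theorem computable_zpow {σ : F ≃+* F} (hF : IsComputableDiffField σ) (a : F) :
    Computable fun z : ℤ => a ^ z := by
  refine (hF.mul.comp
    (Computable.pow_of_mul hF.mul (Computable.const a) Primrec.int_toNat.to_comp)
    (Computable.pow_of_mul hF.mul (Computable.const a⁻¹) Primrec.int_toNat_neg.to_comp)).of_eq
    fun z => ?_
  rcases z with n | n
  · simp
  · simp [zpow_negSucc]

theorem computable_prod_zpow {σ : F ≃+* F} (hF : IsComputableDiffField σ) {k l : ℕ}
    (w : Fin k → F) (e : Fin k → Fin l) :
    Computable fun m : Fin l → ℤ => ∏ i, w i ^ m (e i) :=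
  Computable.prod_finset hF.mul _ fun i =>
    (computable_zpow hF (w i)).comp (Primrec.int_fun_apply (e i)).to_comp

theorem IsPExtension.isComputableDiffRing {E : Type*} [CommRing E] [Algebra F E] {σ : F ≃+* F}
    {σE : E ≃+* E} {k : ℕ} {x : Fin k → Eˣ} {α : Fin k → Fˣ} (h : IsPExtension σ σE x α)
    (hF : IsComputableDiffField σ) : IsComputableDiffRing (laurentRep (F := F) x) σE :=
  isComputableDiffRing_termRep hF (mon := laurentMonomial x) (b := laurentMonomial x)
    Computable.id (fun _ => rfl) h.linearIndependent h.span_eq_top Primrec.int_fun_add.to_comp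
    (laurentMonomial_add x) σE h.extends_aut
    (χ := laurentMonomial α)
    ((computable_prod_zpow hF (fun i => (α i : F)) id).of_eq fun m =>
      (laurentMonomial_units_eq α m).symm)
    (aut_laurentMonomial σE h.shift_gen)

theorem laurentRootRep_eq_termRep {F E B : Type*} [Field F] [CommRing E] [Algebra F E] [CommRing B]
    [Algebra E B] {k : ℕ} (x : Fin k → Eˣ) (z : B) :
    laurentRootRep (F := F) x z = termRep ((algebraMap E B).comp (algebraMap F E))
      (fun p : (Fin k → ℤ) × ℕ => algebraMap E B (laurentMonomial x p.1) * z ^ p.2) := by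
  funext t
  simp only [laurentRootRep, termRep]
  congr 1
  exact List.map_congr_left fun q _ => by simp [mul_assoc]

theorem IsAExtension.isComputableDiffRing {E : Type*} [CommRing E] [Algebra F E] [Algebra E B]
    {σ : F ≃+* F} {σE : E ≃+* E} {σB : B ≃+* B} {k : ℕ} {x : Fin k → Eˣ} {α : Fin k → Fˣ}
    (h : IsPExtension σ σE x α) {z : B} {n : ℕ} {ρ : F}
    (hB : IsAExtension σE σB z n (algebraMap F E ρ)) (hF : IsComputableDiffField σ) :
    IsComputableDiffRing (laurentRootRep (F := F) x z) σB := by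
  let : Algebra F B := ((algebraMap E B).comp (algebraMap F E)).toAlgebra
  have : IsScalarTower F E B := IsScalarTower.of_algebraMap_eq fun _ => rfl
  have hn : 0 < n := zero_lt_one.trans hB.one_lt
  have : NeZero n := ⟨hn.ne'⟩
  let mon : (Fin k → ℤ) × ℕ → B := fun p => algebraMap E B (laurentMonomial x p.1) * z ^ p.2
  have hr : Computable fun p : (Fin k → ℤ) × ℕ => (p.1, Fin.ofNat n p.2) :=
    Computable.fst.pair (Primrec.to_comp (Primrec.fin_val_iff.1
      (Primrec.nat_mod.comp Primrec.snd (Primrec.const n))))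
  have hop : Computable₂ fun p q : (Fin k → ℤ) × ℕ => (p.1 + q.1, p.2 + q.2) :=
    (Primrec.int_fun_add.to_comp.comp (Computable.fst.comp .fst)
      (Computable.fst.comp .snd)).pair (Primrec.nat_add.to_comp.comp (Computable.snd.comp .fst)
      (Computable.snd.comp .snd))
  have hχ : Computable fun p : (Fin k → ℤ) × ℕ => laurentMonomial α p.1 * ρ ^ p.2 :=
    hF.mul.comp (((computable_prod_zpow hF (fun i => (α i : F)) id).of_eq fun m =>
      (laurentMonomial_units_eq α m).symm).comp .fst)
      (Computable.pow_of_mul hF.mul (Computable.const ρ) .snd)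
  have hspan : Submodule.span F (Set.range mon) = ⊤ := by
    rw [eq_top_iff, ← Submodule.restrictScalars_top F E B, ← hB.span_eq_top,
      ← Submodule.span_smul_of_span_eq_top h.span_eq_top]
    refine Submodule.span_mono ?_
    rintro _ ⟨_, ⟨m, rfl⟩, _, ⟨e, rfl⟩, rfl⟩
    exact ⟨(m, (e : ℕ)), (Algebra.smul_def _ _).symm⟩
  have hb : ∀ p : (Fin k → ℤ) × ℕ,
      mon p = laurentMonomial x p.1 • z ^ ((Fin.ofNat n p.2 : Fin n) : ℕ) := by
    rintro ⟨m, e⟩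
    simp only [mon, Algebra.smul_def, Fin.val_ofNat]
    rw [← pow_eq_pow_mod e hB.pow_eq_one]
  have hmul : ∀ p q, mon p * mon q = mon (p.1 + q.1, p.2 + q.2) := by
    rintro ⟨m, e⟩ ⟨m', e'⟩
    simp only [mon, ← laurentMonomial_add, map_mul, pow_add]
    ring
  have hmon : ∀ p, σB (mon p) = algebraMap F B (laurentMonomial α p.1 * ρ ^ p.2) * mon p := by
    rintro ⟨m, e⟩
    change σB _ = algebraMap E B (algebraMap F E _) * _
    simp only [mon, map_mul, map_pow, hB.extends_aut, hB.shift_gen,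
      aut_laurentMonomial σE h.shift_gen, mul_pow]
    ring
  rw [laurentRootRep_eq_termRep]
  exact isComputableDiffRing_termRep hF hr hb
    (linearIndependent_smul h.linearIndependent hB.linearIndependent) hspan hop hmul σB
    (fun a => (hB.extends_aut _).trans (congrArg _ (h.extends_aut a))) hχ hmon

end TermLists

/-! ### Sequences -/

section Sequences

variable {K : Type*} [Field K]

theorem exists_const_of_seqShift_eq {y : SeqRing K} (h : seqShift K y = y) :
    ∃ c : K, y = toSeq fun _ => c := by
  induction y using Germ.inductionOn with
  | _ f =>
    obtain ⟨N, hN⟩ := eventually_atTop.1 (Germ.coe_eq.1 h)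
    refine ⟨f N, Germ.coe_eq.2 (eventually_atTop.2 ⟨N, fun n hn => ?_⟩)⟩
    induction n, hn using Nat.le_induction with
    | base => rfl
    | succ n hn ih => exact (hN n hn).trans ih

variable (K) in
/-- The sequence `(w ^ k)_{k ≥ 0}`, as a multiplicative function of `w`. -/
def geomSeq : K →* SeqRing K where
  toFun w := toSeq fun k => w ^ k
  map_one' := by
    refine Germ.coe_eq.2 (Eventually.of_forall fun k => ?_)
    simp
  map_mul' w w' := by
    refine Germ.coe_eq.2 (Eventually.of_forall fun k => ?_)
    simp [mul_pow]

theorem geomSeq_injective : Function.Injective (geomSeq K) := by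
  intro w w' h
  obtain ⟨N, hN⟩ := eventually_atTop.1 (Germ.coe_eq.1 h)
  have h1 : w ^ N = w' ^ N := hN N le_rfl
  have h2 : w ^ (N + 1) = w' ^ (N + 1) := hN (N + 1) (Nat.le_succ N)
  by_cases hw : w = 0
  · rw [hw, zero_pow N.succ_ne_zero] at h2
    rw [hw, eq_zero_of_pow_eq_zero h2.symm]
  · rw [pow_succ, pow_succ, ← h1] at h2
    exact mul_left_cancel₀ (pow_ne_zero N hw) h2

theorem seqShift_geomSeq (w : K) :
    seqShift K (geomSeq K w) = (toSeq fun _ => w) * geomSeq K w := by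
  refine Germ.coe_eq.2 (Eventually.of_forall fun k => ?_)
  simp [pow_succ']

end Sequences

/-! ### Linear independence of solutions of inequivalent first-order equations -/

theorem eq_zero_of_sum_eq_zero {F R I : Type*} [Field F] [CommRing R] {σ : F ≃+* F} (S : R ≃+* R)
    (φ : F →+* R) (hφ : ∀ a, φ (σ a) = S (φ a)) {y : I → R} {a : I → F} (hy0 : ∀ i, y i ≠ 0)
    (ha : ∀ i, a i ≠ 0) (hy : ∀ i, S (y i) = φ (a i) * y i)
    (hinj : ∀ i j, a i / a j ∈ homogeneousGroup σ → i = j) (t : Finset I) (f : I → F)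
    (hf : ∑ i ∈ t, φ (f i) * y i = 0) : ∀ i ∈ t, f i = 0 := by
  classical
  induction t using Finset.induction_on generalizing f with
  | empty => simp
  | insert i₀ t hi₀ ih =>
    rw [Finset.sum_insert hi₀] at hf
    have hzero : f i₀ = 0 ∨ ∀ i ∈ t, f i = 0 := by
      by_contra! hcon
      obtain ⟨hf₀, i, hi, hfi⟩ := hcon
      have hS : φ (σ (f i₀)) * φ (a i₀) * y i₀ + ∑ i ∈ t, φ (σ (f i)) * φ (a i) * y i = 0 := by
        have := congrArg S hf
        simpa only [map_add, map_mul, map_sum, map_zero, ← hφ, hy, ← mul_assoc] using this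
      have hcomb : ∑ i ∈ t, φ (f i₀ * σ (f i) * a i - σ (f i₀) * a i₀ * f i) * y i = 0 := by
        have e1 : ∑ i ∈ t, φ (f i₀ * σ (f i) * a i - σ (f i₀) * a i₀ * f i) * y i =
            φ (f i₀) * ∑ i ∈ t, φ (σ (f i)) * φ (a i) * y i -
              φ (σ (f i₀)) * φ (a i₀) * ∑ i ∈ t, φ (f i) * y i := by
          rw [Finset.mul_sum, Finset.mul_sum, ← Finset.sum_sub_distrib]
          refine Finset.sum_congr rfl fun i _ => ?_
          simp only [map_sub, map_mul]
          ring
        rw [e1]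
        linear_combination φ (f i₀) * hS - φ (σ (f i₀)) * φ (a i₀) * hf
      have hi' := sub_eq_zero.1 (ih _ hcomb i hi)
      refine hi₀ ((hinj i₀ i ⟨f i / f i₀, div_ne_zero hfi hf₀, ?_⟩) ▸ hi)
      have hσ₀ : σ (f i₀) ≠ 0 := by simpa using hf₀
      rw [map_div₀]
      field_simp [ha i]
      linear_combination -hi'
    rcases hzero with h₀ | h
    · rw [h₀, map_zero, zero_mul, zero_add] at hf
      intro i hi
      rcases Finset.mem_insert.1 hi with rfl | hi
      · exact h₀
      · exact ih f hf i hi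
    · rw [Finset.sum_eq_zero fun i hi => by rw [h i hi, map_zero, zero_mul], add_zero] at hf
      intro i hi
      rcases Finset.mem_insert.1 hi with rfl | hi
      · by_contra hne
        refine hy0 i ?_
        have := congrArg (fun v => φ (f i)⁻¹ * v) hf
        simpa [← mul_assoc, ← map_mul, hne] using this
      · exact h i hi

/-! ### Generalities on `P`-extensions and `K`-embeddings -/

section General

theorem IsKEmbedding.exists_const {K A : Type*} [Field K] [CommRing A] {σA : A ≃+* A}
    {incl : K →+* A} {τ : A →+* SeqRing K} (h : IsKEmbedding σA incl τ) {b : A} (hb : σA b = b) :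
    ∃ c, incl c = b := by
  obtain ⟨c, hc⟩ := exists_const_of_seqShift_eq (K := K) (y := τ b) (by rw [← h.diffHom, hb])
  exact ⟨c, h.injective (by rw [h.const, hc])⟩

theorem exists_ringHom_lift {E H S : Type*} [CommRing E] [CommRing H] [CommRing S] {ι : E →+* S}
    (hι : Function.Injective ι) (τ : H →+* S) (h : ∀ f, ∃ e, ι e = τ f) :
    ∃ lam : H →+* E, ∀ f, ι (lam f) = τ f := by
  choose lam hlam using h
  exact ⟨{ toFun := lam
           map_one' := hι (by rw [hlam, map_one, map_one])
           map_mul' := fun a b => hι (by rw [hlam, map_mul, map_mul, hlam, hlam])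
           map_zero' := hι (by rw [hlam, map_zero, map_zero])
           map_add' := fun a b => hι (by rw [hlam, map_add, map_add, hlam, hlam]) }, hlam⟩

variable {F H : Type*} [Field F] [CommRing H] [Algebra F H] {k : ℕ}

theorem laurentMonomial_mem {B : Type*} [CommRing B] (R : Subring B) {x : Fin k → Bˣ}
    (hx : ∀ i, (x i : B) ∈ R) (hx' : ∀ i, ((x i)⁻¹ : Bˣ).val ∈ R) (m : Fin k → ℤ) :
    laurentMonomial x m ∈ R := by
  rw [laurentMonomial, Units.coe_prod]
  refine Subring.prod_mem _ fun i _ => ?_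
  rcases m i with n | n
  · simpa using R.pow_mem (hx i) n
  · rw [zpow_negSucc, ← inv_pow, Units.val_pow_eq_pow_val]
    exact R.pow_mem (hx' i) _

theorem IsPExtension.map_mem {σ : F ≃+* F} {σH : H ≃+* H} {x : Fin k → Hˣ} {α : Fin k → Fˣ}
    (h : IsPExtension σ σH x α) {B : Type*} [CommRing B] (f : H →+* B) (R : Subring B)
    (ha : ∀ a, f (algebraMap F H a) ∈ R) (hx : ∀ i, f (x i) ∈ R)
    (hx' : ∀ i, f ((x i)⁻¹ : Hˣ).val ∈ R) (y : H) : f y ∈ R := by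
  have hy : y ∈ Submodule.span F (Set.range (laurentMonomial x)) := h.span_eq_top ▸ Submodule.mem_top
  induction hy using Submodule.span_induction with
  | mem y hy =>
    obtain ⟨m, rfl⟩ := hy
    rw [map_laurentMonomial]
    exact laurentMonomial_mem R hx hx' m
  | zero => simp
  | add y z _ _ hy hz => rw [map_add]; exact R.add_mem hy hz
  | smul c y _ hy => rw [Algebra.smul_def, map_mul]; exact R.mul_mem (ha c) hy

theorem mem_relModule_iff {σ : F ≃+* F} {r : ℕ} {α : Fin r → Fˣ} {m : Fin r → ℤ} :
    m ∈ relModule σ α ↔ laurentMonomial α m ∈ homogeneousGroup σ := by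
  rw [laurentMonomial_units_eq]
  rfl

end General

/-! ### The tail ring -/

section Tail

variable {F : Type*} [Field F] {H : Type*} [CommRing H] [Algebra F H] {u s : ℕ}

/-- Extension of an exponent vector of the tail variables by zeros. -/
def tailExp (u : ℕ) {s : ℕ} (m : Fin s → ℤ) : Fin (u + s) → ℤ := Fin.append 0 m

theorem tailExp_castAdd (m : Fin s → ℤ) (i : Fin u) : tailExp u m (Fin.castAdd s i) = 0 := by
  simp [tailExp]

theorem tailExp_natAdd (m : Fin s → ℤ) (j : Fin s) : tailExp u m (Fin.natAdd u j) = m j := by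
  simp [tailExp]

theorem laurentMonomial_tailExp {B : Type*} [CommRing B] (x : Fin (u + s) → Bˣ) (m : Fin s → ℤ) :
    laurentMonomial x (tailExp u m) = laurentMonomial (fun j => x (Fin.natAdd u j)) m := by
  rw [laurentMonomial_split]
  simp only [tailExp_castAdd, tailExp_natAdd]
  have : (fun _ : Fin u => (0 : ℤ)) = 0 := rfl
  rw [this, laurentMonomial_zero, one_mul]

theorem coe_laurentMonomial_tailGen (x : Fin (u + s) → Hˣ) (m : Fin s → ℤ) :
    ((laurentMonomial (tailGen F x) m : tailRing F x) : H) = laurentMonomial (fun j => x (Fin.natAdd u j)) m := by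
  refine (map_laurentMonomial (tailRing F x).val.toRingHom (tailGen F x) m).trans ?_
  congr 1

theorem map_unit_ne_zero {A B : Type*} [CommRing A] [CommRing B] [Nontrivial B] (f : A →+* B)
    (y : Aˣ) : f y ≠ 0 :=
  (Units.map (f : A →* B) y).ne_zero

theorem laurentMonomial_ne_zero {B : Type*} [CommRing B] [Nontrivial B] {k : ℕ} (x : Fin k → Bˣ)
    (m : Fin k → ℤ) : laurentMonomial x m ≠ 0 := Units.ne_zero _

theorem natAdd_ne_castAdd (i : Fin u) (j : Fin s) : Fin.natAdd u j ≠ Fin.castAdd s i := fun e => by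
  have := congrArg Fin.val e
  simp only [Fin.val_natAdd, Fin.val_castAdd] at this
  omega

theorem span_laurentMonomial_tailGen (x : Fin (u + s) → Hˣ) :
    Submodule.span F (Set.range (laurentMonomial (tailGen F x))) = ⊤ := by
  rw [eq_top_iff]
  rintro e -
  have hspan : (e : H) ∈ Submodule.span F
      (Set.range (laurentMonomial fun j : Fin s => x (Fin.natAdd u j))) := by
    have he : (e : H) ∈ Subalgebra.toSubmodule (tailRing F x) := e.2
    simp only [tailRing, Algebra.adjoin_eq_span] at he
    refine Submodule.span_mono ?_ he
    intro y hy
    induction hy using Submonoid.closure_induction with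
    | mem y hy =>
      obtain ⟨j, hj⟩ := Set.mem_iUnion.1 hy
      rcases hj with rfl | rfl
      · exact ⟨Pi.single j 1, by simp [laurentMonomial_single]⟩
      · exact ⟨Pi.single j (-1), by simp [laurentMonomial_single]⟩
    | one => exact ⟨0, laurentMonomial_zero _⟩
    | mul y z _ _ hy hz =>
      obtain ⟨m, rfl⟩ := hy
      obtain ⟨m', rfl⟩ := hz
      exact ⟨m + m', (laurentMonomial_add _ m m').symm⟩
  have hmap : Submodule.map (tailRing F x).val.toLinearMap
      (Submodule.span F (Set.range (laurentMonomial (tailGen F x)))) = Submodule.span F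
      (Set.range (laurentMonomial fun j : Fin s => x (Fin.natAdd u j))) := by
    rw [Submodule.map_span, ← Set.range_comp]
    congr 2
    funext m
    exact coe_laurentMonomial_tailGen x m
  rw [← hmap] at hspan
  obtain ⟨e', he', h⟩ := hspan
  rwa [← Subtype.ext (a1 := e') (a2 := e) h]

variable {σ : F ≃+* F} {σH : H ≃+* H} {x : Fin (u + s) → Hˣ} {α : Fin (u + s) → Fˣ}

theorem IsPExtension.linearIndependent_tailGen (h : IsPExtension σ σH x α) :
    LinearIndependent F (laurentMonomial (tailGen F x)) := by
  refine LinearIndependent.of_comp (tailRing F x).val.toLinearMap ?_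
  have hinj : Function.Injective (tailExp u (s := s)) := fun m m' hm => by
    funext j
    simpa only [tailExp_natAdd] using congrFun hm (Fin.natAdd u j)
  have hcomp : (tailRing F x).val.toLinearMap ∘ laurentMonomial (tailGen F x) =
      laurentMonomial x ∘ tailExp u := funext fun m =>
    (coe_laurentMonomial_tailGen x m).trans (laurentMonomial_tailExp x m).symm
  rw [hcomp]
  exact h.linearIndependent.comp _ hinj

theorem laurentMonomial_mem_tailRing (x : Fin (u + s) → Hˣ) (m : Fin s → ℤ) :
    laurentMonomial (fun j => x (Fin.natAdd u j)) m ∈ tailRing F x := by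
  rw [← coe_laurentMonomial_tailGen (F := F)]
  exact Subtype.property _

theorem exists_tail_sum (e : tailRing F x) : ∃ f : (Fin s → ℤ) →₀ F,
    f.sum (fun m a => a • laurentMonomial (tailGen F x) m) = e :=
  Finsupp.mem_span_range_iff_exists_finsupp.1
    (span_laurentMonomial_tailGen (F := F) x ▸ Submodule.mem_top)

/-- An additive map sending all terms `a x^m` of the tail ring to the tail ring preserves it. -/
theorem map_mem_tailRing (θ : H →+ H)
    (hθ : ∀ (a : F) (m : Fin s → ℤ),
      θ (algebraMap F H a * laurentMonomial (fun j => x (Fin.natAdd u j)) m) ∈ tailRing F x)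
    (e : tailRing F x) : θ e ∈ tailRing F x := by
  obtain ⟨f, rfl⟩ := exists_tail_sum e
  rw [Finsupp.sum, AddSubmonoidClass.coe_finsetSum, map_sum]
  refine Subalgebra.sum_mem _ fun m _ => ?_
  rw [Subalgebra.coe_smul, coe_laurentMonomial_tailGen, Algebra.smul_def]
  exact hθ _ m

theorem IsPExtension.exists_tail_aut (h : IsPExtension σ σH x α) :
    ∃ σE : tailRing F x ≃+* tailRing F x, ∀ e, (σE e : H) = σH e := by
  have hshift := aut_laurentMonomial (A := F) σH (x := fun j : Fin s => x (Fin.natAdd u j))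
    (α := fun j : Fin s => α (Fin.natAdd u j)) fun j => h.shift_gen (Fin.natAdd u j)
  have h1 : ∀ e : tailRing F x, σH e ∈ tailRing F x :=
    map_mem_tailRing (σH : H →+ H) fun a m => by
      change σH _ ∈ _
      rw [map_mul, h.extends_aut, hshift]
      exact Subalgebra.mul_mem _ (Subalgebra.algebraMap_mem _ _) (Subalgebra.mul_mem _
        (Subalgebra.algebraMap_mem _ _) (laurentMonomial_mem_tailRing x m))
  have h2 : ∀ e : tailRing F x, σH.symm e ∈ tailRing F x :=
    map_mem_tailRing (σH.symm : H →+ H) fun a m => by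
      change σH.symm _ ∈ _
      set w : F := laurentMonomial (fun j : Fin s => α (Fin.natAdd u j)) m with hw
      have hw0 : w ≠ 0 := Units.ne_zero _
      have : σH.symm (algebraMap F H a * laurentMonomial (fun j => x (Fin.natAdd u j)) m) =
          algebraMap F H (σ.symm (a * w⁻¹)) * laurentMonomial (fun j => x (Fin.natAdd u j)) m := by
        rw [RingEquiv.symm_apply_eq, map_mul, h.extends_aut, hshift, RingEquiv.apply_symm_apply,
          ← mul_assoc, ← map_mul, ← hw, mul_assoc, inv_mul_cancel₀ hw0, mul_one]
      rw [this]
      exact Subalgebra.mul_mem _ (Subalgebra.algebraMap_mem _ _) (laurentMonomial_mem_tailRing x m)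
  exact ⟨{ toFun := fun e => ⟨σH e, h1 e⟩
           invFun := fun e => ⟨σH.symm e, h2 e⟩
           left_inv := fun e => Subtype.ext (σH.symm_apply_apply _)
           right_inv := fun e => Subtype.ext (σH.apply_symm_apply _)
           map_mul' := fun a b => Subtype.ext (map_mul σH _ _)
           map_add' := fun a b => Subtype.ext (map_add σH _ _) }, fun _ => rfl⟩

end Tail

/-! ### Consequences of the hypotheses -/

namespace SpecialCase

variable {F : Type*} [Field F] {H : Type*} [CommRing H] [Algebra F H] {u s : ℕ}
  {σ : F ≃+* F} {τF : F →+* SeqRing (constField σ)} {σH : H ≃+* H}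
  {x : Fin (u + s) → Hˣ} {α : Fin (u + s) → Fˣ} {τ : H →+* SeqRing (constField σ)}
  {d : Fin u → ℕ}

theorem tau_shift (h : SpecialCase σ τF σH x α τ d) (a : F) :
    τ (algebraMap F H (σ a)) = seqShift _ (τ (algebraMap F H a)) := by
  rw [← h.isKHom.diffHom, h.isPExtension.extends_aut]

theorem tau_const (h : SpecialCase σ τF σH x α τ d) (c : constField σ) :
    τ (algebraMap F H c) = toSeq fun _ => c := h.isKHom.const c

theorem d_pos (h : SpecialCase σ τF σH x α τ d) (i : Fin u) : 0 < d i := by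
  refine Nat.pos_of_ne_zero fun h0 => h.basis_linearIndependent.ne_zero i ?_
  simp [h0]

theorem mem_relModule (h : SpecialCase σ τF σH x α τ d) {m : Fin (u + s) → ℤ} :
    m ∈ relModule σ α ↔
      (∀ i : Fin u, (d i : ℤ) ∣ m (Fin.castAdd s i)) ∧ ∀ j : Fin s, m (Fin.natAdd u j) = 0 := by
  rw [← h.basis_span, Submodule.mem_span_range_iff_exists_fun]
  constructor
  · rintro ⟨c, rfl⟩
    refine ⟨fun i => ⟨c i, ?_⟩, fun j => ?_⟩
    · rw [Finset.sum_apply, Finset.sum_eq_single i]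
      · simp [mul_comm]
      · intro i' _ hi'
        have : Fin.castAdd s i ≠ Fin.castAdd s i' := fun e =>
          hi' (Fin.castAdd_injective u s e).symm
        simp [Pi.single_eq_of_ne this]
      · simp
    · rw [Finset.sum_apply]
      refine Finset.sum_eq_zero fun i _ => ?_
      simp [Pi.single_eq_of_ne (natAdd_ne_castAdd i j)]
  · rintro ⟨h1, h2⟩
    choose c hc using h1
    refine ⟨c, ?_⟩
    funext l
    rw [Finset.sum_apply]
    refine Fin.addCases (fun i => ?_) (fun j => ?_) l
    · rw [Finset.sum_eq_single i]
      · simp [hc, mul_comm]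
      · intro i' _ hi'
        have : Fin.castAdd s i ≠ Fin.castAdd s i' := fun e =>
          hi' (Fin.castAdd_injective u s e).symm
        simp [Pi.single_eq_of_ne this]
      · simp
    · rw [h2]
      refine Finset.sum_eq_zero fun i _ => ?_
      simp [Pi.single_eq_of_ne (natAdd_ne_castAdd i j)]

theorem zpow_mem_iff (h : SpecialCase σ τF σH x α τ d) (i : Fin u) (z : ℤ) :
    (α (Fin.castAdd s i) : F) ^ z ∈ homogeneousGroup σ ↔ (d i : ℤ) ∣ z := by
  have := mem_relModule_iff (σ := σ) (α := α) (m := Pi.single (Fin.castAdd s i) z)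
  rw [laurentMonomial_single, Units.val_zpow_eq_zpow_val] at this
  rw [← this, h.mem_relModule]
  refine ⟨fun h' => by simpa using h'.1 i, fun h' => ⟨fun i' => ?_, fun j => ?_⟩⟩
  · by_cases e : i' = i
    · subst e
      simpa using h'
    · have : Fin.castAdd s i' ≠ Fin.castAdd s i := fun e' => e (Fin.castAdd_injective u s e')
      simp [Pi.single_eq_of_ne this]
  · simp [Pi.single_eq_of_ne (natAdd_ne_castAdd i j)]

theorem tau_sum_eq_zero (h : SpecialCase σ τF σH x α τ d) {I : Type*} {e : I → Fin (u + s) → ℤ}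
    (he : ∀ i j, e i - e j ∈ relModule σ α → i = j) (t : Finset I) (f : I → F)
    (hf : ∑ i ∈ t, τ (algebraMap F H (f i) * laurentMonomial x (e i)) = 0) :
    ∀ i ∈ t, f i = 0 := by
  refine eq_zero_of_sum_eq_zero (seqShift _) (τ.comp (algebraMap F H)) h.tau_shift
    (y := fun i => τ (laurentMonomial x (e i))) (a := fun i => laurentMonomial α (e i))
    (fun i => map_unit_ne_zero τ _) (fun i => Units.ne_zero _) (fun i => ?_) (fun i j hij => ?_) t f
    (by simpa only [map_mul] using! hf)
  · rw [← h.isKHom.diffHom, aut_laurentMonomial (A := F) σH h.isPExtension.shift_gen, map_mul]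
    rfl
  · refine he i j (mem_relModule_iff.2 ?_)
    have hd : laurentMonomial α (e i - e j) = laurentMonomial α (e i) / laurentMonomial α (e j) := by
      rw [eq_div_iff (laurentMonomial_ne_zero α (e j)), laurentMonomial_add, sub_add_cancel]
    rwa [hd]

theorem tailTau_injective (h : SpecialCase σ τF σH x α τ d) :
    Function.Injective (tailTau (F := F) x τ) := by
  refine (injective_iff_map_eq_zero _).2 fun e he => ?_
  obtain ⟨f, rfl⟩ := exists_tail_sum e
  have hz := h.tau_sum_eq_zero (e := tailExp u (s := s)) (fun m m' hm => ?_) f.support f ?_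
  · exact Finset.sum_eq_zero fun m hm => by simp [hz m hm]
  · funext j
    have := (h.mem_relModule.1 hm).2 j
    simpa only [Pi.sub_apply, tailExp_natAdd, sub_eq_zero] using this
  · rw [← he, Finsupp.sum, map_sum]
    refine Finset.sum_congr rfl fun m _ => ?_
    change _ = τ _
    rw [Algebra.smul_def, laurentMonomial_tailExp]
    congr 1
    rw [← coe_laurentMonomial_tailGen (F := F)]
    rfl

theorem tailStatement (h : SpecialCase σ τF σH x α τ d) {σE : tailRing F x ≃+* tailRing F x}
    (hσE : ∀ e, (σE e : H) = σH e) : TailStatement σ σH x α τ σE := by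
  have hemb : IsKEmbedding σE (constIncl σ (tailRing F x)) (tailTau x τ) :=
    { diffHom := fun e => by
        change τ (σE e : H) = seqShift _ (τ (e : H))
        rw [hσE, h.isKHom.diffHom]
      const := h.tau_const
      injective := h.tailTau_injective }
  refine ⟨hσE, { extends_aut := fun a => Subtype.ext ?_
                 linearIndependent := h.isPExtension.linearIndependent_tailGen
                 span_eq_top := span_laurentMonomial_tailGen x
                 shift_gen := fun j => Subtype.ext ?_
                 noNewConstants := fun b hb => ?_ }, hemb⟩
  · rw [hσE]
    exact h.isPExtension.extends_aut a
  · rw [hσE]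
    exact h.isPExtension.shift_gen _
  · obtain ⟨c, hc⟩ := hemb.exists_const hb
    exact ⟨c, c.2, hc⟩

end SpecialCase

/-! ### Reduction data -/

section Reduction

variable {F : Type*} [Field F] {H : Type*} [CommRing H] [Algebra F H] {u s : ℕ}

/-- The elements `ρ, νᵢ, ḡᵢ, cᵢ` describe `τ` on the first `u` generators:
`τ(xᵢ) = cᵢ ḡᵢ (ρ^k)_k^(n - νᵢ)`. -/
structure IsReduction (σ : F ≃+* F) (x : Fin (u + s) → Hˣ) (α : Fin (u + s) → Fˣ)
    (τ : H →+* SeqRing (constField σ)) (d : Fin u → ℕ) (n : ℕ) (ρ : constField σ) (ν : Fin u → ℕ)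
    (g : Fin u → Fˣ) (c : Fin u → constField σ) : Prop where
  rho_pow : ρ ^ n = 1
  nu_lt : ∀ i, ν i < n
  shift_g : ∀ i, σ (g i) = (ρ : F) ^ ν i * α (Fin.castAdd s i) * g i
  rho_nu_pow : ∀ i, (ρ ^ ν i) ^ d i = 1
  c_ne_zero : ∀ i, c i ≠ 0
  tau_gen : ∀ i, τ (x (Fin.castAdd s i)) =
    τ (algebraMap F H (c i * g i)) * geomSeq _ (ρ ^ (n - ν i))

variable {σ : F ≃+* F} {τF : F →+* SeqRing (constField σ)} {σH : H ≃+* H}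
  {x : Fin (u + s) → Hˣ} {α : Fin (u + s) → Fˣ} {τ : H →+* SeqRing (constField σ)}
  {d : Fin u → ℕ} {n : ℕ} {ρ : constField σ} {ν : Fin u → ℕ} {g : Fin u → Fˣ}
  {c : Fin u → constField σ}

/-- If `σ g = ω α g` with `ω ∈ K` and `ω ^ d = 1`, then `ω` has order `d`. -/
theorem SpecialCase.orderOf_eq (h : SpecialCase σ τF σH x α τ d) {i : Fin u} {ω : constField σ}
    {g : F} (hg : g ≠ 0) (hω : σ g = ω * α (Fin.castAdd s i) * g) (hd : ω ^ d i = 1) :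
    orderOf ω = d i := by
  refine Nat.dvd_antisymm (orderOf_dvd_of_pow_eq_one hd) ?_
  rw [← Int.natCast_dvd_natCast, ← h.zpow_mem_iff, zpow_natCast]
  refine ⟨g ^ orderOf ω, pow_ne_zero _ hg, ?_⟩
  have h1 : (ω : F) ^ orderOf ω = 1 := by exact_mod_cast congrArg Subtype.val (pow_orderOf_eq_one ω)
  rw [map_pow, hω, mul_pow, mul_pow, h1, one_mul, mul_div_cancel_right₀ _ (pow_ne_zero _ hg)]

theorem constField_apply (c : constField σ) : σ (c : F) = c := c.2

theorem SpecialCase.exists_c (h : SpecialCase σ τF σH x α τ d) (hρ : ρ ^ n = 1) {i : Fin u} {e : ℕ}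
    (he : e ≤ n) {g : Fˣ} (hg : σ g = (ρ : F) ^ e * α (Fin.castAdd s i) * g) :
    ∃ c : constField σ, c ≠ 0 ∧ τ (x (Fin.castAdd s i)) =
      τ (algebraMap F H (c * g)) * geomSeq _ (ρ ^ (n - e)) := by
  have hρF : (ρ : F) ^ n = 1 := by exact_mod_cast congrArg Subtype.val hρ
  have hρ0 : (ρ : F) ^ e ≠ 0 := by
    refine left_ne_zero_of_mul_eq_one (b := (ρ : F) ^ (n - e)) ?_
    rw [← pow_add, Nat.add_sub_cancel' he, hρF]
  set y := τ (x (Fin.castAdd s i)) * (τ (algebraMap F H (g : F)⁻¹) * geomSeq _ (ρ ^ e)) with hy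
  have hshift : seqShift _ y = y := by
    rw [hy, map_mul, map_mul, ← h.isKHom.diffHom, h.isPExtension.shift_gen, map_mul, ← h.tau_shift,
      map_inv₀, hg, seqShift_geomSeq, ← h.tau_const]
    have hα : (α (Fin.castAdd s i) : F) ≠ 0 := Units.ne_zero _
    have key : (α (Fin.castAdd s i) : F) * ((ρ : F) ^ e * α (Fin.castAdd s i) * g)⁻¹ *
        ((ρ ^ e : constField σ) : F) = (g : F)⁻¹ := by
      push_cast
      field_simp
    rw [← key]
    simp only [map_mul]
    ring
  obtain ⟨c, hc⟩ := exists_const_of_seqShift_eq hshift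
  have hτ : τ (x (Fin.castAdd s i)) =
      τ (algebraMap F H (c * g)) * geomSeq _ (ρ ^ (n - e)) := by
    have h1 : τ (algebraMap F H (g : F)⁻¹) * τ (algebraMap F H g) = 1 := by
      rw [← map_mul, ← map_mul, inv_mul_cancel₀ g.ne_zero, map_one, map_one]
    have h2 : geomSeq _ (ρ ^ e) * geomSeq _ (ρ ^ (n - e)) = 1 := by
      rw [← map_mul, ← pow_add, Nat.add_sub_cancel' he, hρ, map_one]
    rw [map_mul, map_mul, h.tau_const, ← hc, hy]
    linear_combination (-τ (x (Fin.castAdd s i))) * h1 -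
      τ (x (Fin.castAdd s i)) * τ (algebraMap F H (g : F)⁻¹) * τ (algebraMap F H g) * h2
  refine ⟨c, ?_, hτ⟩
  rintro rfl
  refine map_unit_ne_zero τ (x (Fin.castAdd s i)) (hτ.trans ?_)
  simp

theorem SpecialCase.exists_isReduction (h : SpecialCase σ τF σH x α τ d) (hσ : RadicalStable σ)
    (hu : 0 < u) : ∃ (ρ : constField σ) (ν : Fin u → ℕ) (g : Fin u → Fˣ) (c : Fin u → constField σ),
      IsReduction σ x α τ d (lastEntry hu d) ρ ν g c := by
  have hex : ∀ i : Fin u, ∃ (ω : constField σ) (g : Fˣ), ω ^ d i = 1 ∧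
      σ g = ω * α (Fin.castAdd s i) * g := by
    intro i
    have hmem : (α (Fin.castAdd s i) : F) ^ d i ∈ homogeneousGroup σ := by
      have := (h.zpow_mem_iff i (d i)).2 dvd_rfl
      rwa [zpow_natCast] at this
    obtain ⟨ω, hω, hpow, g, hg, hgω⟩ := hσ _ _ (Units.ne_zero _) (h.d_pos i) hmem
    refine ⟨⟨ω, hω⟩, Units.mk0 g hg, Subtype.ext (by simpa using hpow), ?_⟩
    rw [Units.val_mk0]
    rw [eq_div_iff hg] at hgω
    rw [← hgω]
    ring
  choose ω g hω hg using hex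
  have hord : ∀ i, orderOf (ω i) = d i := fun i => h.orderOf_eq (g i).ne_zero (hg i) (hω i)
  set l : Fin u := ⟨u - 1, Nat.sub_one_lt_of_lt hu⟩ with hl
  have hn : lastEntry hu d = d l := rfl
  have : NeZero (d l) := ⟨(h.d_pos l).ne'⟩
  have hprim : IsPrimitiveRoot (ω l) (d l) := hord l ▸ IsPrimitiveRoot.orderOf (ω l)
  have hν : ∀ i, ∃ e < d l, ω l ^ e = ω i := fun i => by
    refine hprim.eq_pow_of_pow_eq_one ?_
    obtain ⟨q, hq⟩ := h.dvd i l (Fin.le_def.2 (Nat.le_sub_one_of_lt i.2))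
    rw [hq, pow_mul, hω, one_pow]
  choose ν hνlt hν using hν
  have hg' : ∀ i, σ (g i) = (ω l : F) ^ ν i * α (Fin.castAdd s i) * g i := fun i => by
    rw [hg, ← hν i, SubmonoidClass.coe_pow]
  choose c hc0 hc using fun i => h.exists_c (hω l) (hνlt i).le (hg' i)
  exact ⟨ω l, ν, g, c, hn ▸ hω l, hn ▸ hνlt, hg', fun i => by rw [hν, hω], hc0, hc⟩

end Reduction

/-! ### The kernel of `τ` -/

section Kernel

variable {F : Type*} [Field F] {H : Type*} [CommRing H] [Algebra F H] {u s : ℕ}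
  {σ : F ≃+* F} {τF : F →+* SeqRing (constField σ)} {σH : H ≃+* H}
  {x : Fin (u + s) → Hˣ} {α : Fin (u + s) → Fˣ} {τ : H →+* SeqRing (constField σ)}
  {d : Fin u → ℕ} {n : ℕ} {ρ : constField σ} {ν : Fin u → ℕ} {g : Fin u → Fˣ}
  {c : Fin u → constField σ}

/-- Reduction of the first `u` exponents modulo `d₁, …, d_u`. -/
def reducedExp (d : Fin u → ℕ) (m : Fin (u + s) → ℤ) : Fin (u + s) → ℤ :=
  Fin.addCases (fun i => m (Fin.castAdd s i) % d i) fun j => m (Fin.natAdd u j)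

theorem reducedExp_castAdd (d : Fin u → ℕ) (m : Fin (u + s) → ℤ) (i : Fin u) :
    reducedExp d m (Fin.castAdd s i) = m (Fin.castAdd s i) % d i := by
  simp [reducedExp]

theorem reducedExp_natAdd (d : Fin u → ℕ) (m : Fin (u + s) → ℤ) (j : Fin s) :
    reducedExp d m (Fin.natAdd u j) = m (Fin.natAdd u j) := by
  simp [reducedExp]

theorem reducedExp_idem (d : Fin u → ℕ) (m : Fin (u + s) → ℤ) :
    reducedExp d (reducedExp d m) = reducedExp d m := by
  funext l
  refine Fin.addCases (fun i => ?_) (fun j => ?_) l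
  · simp [reducedExp_castAdd]
  · simp [reducedExp_natAdd]

theorem IsReduction.rho_sub_mul (hR : IsReduction σ x α τ d n ρ ν g c) (i : Fin u) :
    ρ ^ (n - ν i) * ρ ^ ν i = 1 := by
  rw [← pow_add, Nat.sub_add_cancel (hR.nu_lt i).le, hR.rho_pow]

theorem IsReduction.rho_sub_pow_eq_one_iff (hR : IsReduction σ x α τ d n ρ ν g c) (i : Fin u)
    (k : ℕ) : (ρ ^ (n - ν i)) ^ k = 1 ↔ (ρ ^ ν i) ^ k = 1 := by
  have h : (ρ ^ (n - ν i)) ^ k * (ρ ^ ν i) ^ k = 1 := by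
    rw [← mul_pow, hR.rho_sub_mul, one_pow]
  exact ⟨fun h1 => by rwa [h1, one_mul] at h, fun h1 => by rwa [h1, mul_one] at h⟩

theorem IsReduction.tau_gen_pow (hR : IsReduction σ x α τ d n ρ ν g c) (i : Fin u) :
    τ (x (Fin.castAdd s i)) ^ d i = τ (algebraMap F H (c i * g i)) ^ d i := by
  rw [hR.tau_gen, mul_pow, ← map_pow (geomSeq (constField σ)),
    (hR.rho_sub_pow_eq_one_iff i _).2 (hR.rho_nu_pow i), map_one, mul_one]

theorem IsReduction.relIdeal_le_ker (hR : IsReduction σ x α τ d n ρ ν g c) :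
    relIdeal x d g c ≤ RingHom.ker τ := by
  refine Ideal.span_le.2 ?_
  rintro _ ⟨i, rfl⟩
  change τ _ = 0
  rw [map_sub, map_pow, map_pow, hR.tau_gen_pow, sub_self]

theorem units_zpow_eq {A : Type*} [CommRing A] {X G : Aˣ} {e : ℕ} (h : (X : A) ^ e = (G : A) ^ e)
    (m : ℤ) : X ^ m = G ^ (e * (m / e)) * X ^ (m % e) := by
  have h' : X ^ (e : ℤ) = G ^ (e : ℤ) := by
    rw [zpow_natCast, zpow_natCast]
    exact Units.ext (by simpa using h)
  conv_lhs => rw [← Int.mul_ediv_add_emod m e, zpow_add, zpow_mul, h', ← zpow_mul]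

/-- Modulo the relations every monomial is a multiple of a reduced one. -/
theorem exists_reduce_monomial (x : Fin (u + s) → Hˣ) (d : Fin u → ℕ) (g : Fin u → Fˣ)
    {c : Fin u → constField σ} (hc : ∀ i, c i ≠ 0) (m : Fin (u + s) → ℤ) :
    ∃ w : F, Ideal.Quotient.mk (relIdeal x d g c) (laurentMonomial x m) =
      Ideal.Quotient.mk (relIdeal x d g c)
        (algebraMap F H w * laurentMonomial x (reducedExp d m)) := by
  set π := Ideal.Quotient.mk (relIdeal x d g c) with hπ
  let G : Fin u → Fˣ := fun i => Units.mk0 (c i : F) (by simpa using hc i) * g i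
  let X : Fin u → (H ⧸ relIdeal x d g c)ˣ := fun i => Units.map (π : H →* _) (x (Fin.castAdd s i))
  let GQ : Fin u → (H ⧸ relIdeal x d g c)ˣ := fun i =>
    Units.map ((π.comp (algebraMap F H) : F →+* _) : F →* _) (G i)
  have hXG : ∀ i, (X i : H ⧸ relIdeal x d g c) ^ d i = (GQ i : H ⧸ relIdeal x d g c) ^ d i := by
    intro i
    have : (x (Fin.castAdd s i) : H) ^ d i - algebraMap F H ((c i : F) * g i) ^ d i ∈
        relIdeal x d g c := Ideal.subset_span ⟨i, rfl⟩
    have := (Ideal.Quotient.mk_eq_mk_iff_sub_mem _ _).2 this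
    rw [map_pow, map_pow] at this
    exact this
  let e : Fin u → ℤ := fun i => d i * (m (Fin.castAdd s i) / d i)
  refine ⟨laurentMonomial G e, ?_⟩
  rw [laurentMonomial_split, laurentMonomial_split x (reducedExp d m)]
  simp only [reducedExp_castAdd, reducedExp_natAdd]
  rw [← mul_assoc, map_mul, map_mul (f := π) (_ * _)]
  congr 1
  rw [map_mul, map_laurentMonomial π, map_laurentMonomial π]
  change _ = (π.comp (algebraMap F H)) _ * _
  rw [map_laurentMonomial (π.comp (algebraMap F H))]
  change laurentMonomial X _ = laurentMonomial GQ e * laurentMonomial X _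
  simp only [laurentMonomial, ← Units.val_mul, ← Finset.prod_mul_distrib]
  congr 1
  exact Finset.prod_congr rfl fun i _ => units_zpow_eq (hXG i) _

theorem SpecialCase.ker_tau_eq_relIdeal (h : SpecialCase σ τF σH x α τ d)
    (hR : IsReduction σ x α τ d n ρ ν g c) : RingHom.ker τ = relIdeal x d g c := by
  refine le_antisymm (fun f hf => ?_) hR.relIdeal_le_ker
  let I := {m : Fin (u + s) → ℤ // reducedExp d m = m}
  let π := Ideal.Quotient.mkₐ F (relIdeal x d g c)
  have hspan : ∀ y : H, π y ∈ Submodule.span F (Set.range fun m : I => π (laurentMonomial x m.1)) := by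
    intro y
    have hy : y ∈ Submodule.span F (Set.range (laurentMonomial x)) :=
      h.isPExtension.span_eq_top ▸ Submodule.mem_top
    induction hy using Submodule.span_induction with
    | mem y hy =>
      obtain ⟨m, rfl⟩ := hy
      obtain ⟨w, hw⟩ := exists_reduce_monomial x d g hR.c_ne_zero m
      have hw' : π (laurentMonomial x m) = w • π (laurentMonomial x (reducedExp d m)) := by
        rw [← map_smul, Algebra.smul_def]
        exact hw
      rw [hw']
      exact Submodule.smul_mem _ _ (Submodule.subset_span ⟨⟨_, reducedExp_idem d m⟩, rfl⟩)
    | zero => simp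
    | add y z _ _ hy hz => rw [map_add]; exact Submodule.add_mem _ hy hz
    | smul a y _ hy => rw [map_smul]; exact Submodule.smul_mem _ _ hy
  obtain ⟨b, hb⟩ := Finsupp.mem_span_range_iff_exists_finsupp.1 (hspan f)
  set f' : H := ∑ m ∈ b.support, algebraMap F H (b m) * laurentMonomial x m.1 with hf'
  have hmem : f - f' ∈ relIdeal x d g c := by
    refine (Ideal.Quotient.mk_eq_mk_iff_sub_mem f f').1 ?_
    change π f = π f'
    rw [← hb, hf', Finsupp.sum, map_sum]
    exact Finset.sum_congr rfl fun m _ => by rw [← map_smul, Algebra.smul_def]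
  have hτ : τ f' = 0 := by
    have h1 : τ (f - f') = 0 := hR.relIdeal_le_ker hmem
    rw [map_sub, show τ f = 0 from hf, zero_sub, neg_eq_zero] at h1
    exact h1
  have hz := h.tau_sum_eq_zero (I := I) (e := Subtype.val) (fun m m' hmm => ?_) b.support b
    (by rw [← map_sum]; exact hτ)
  · have hf'0 : f' = 0 := Finset.sum_eq_zero fun m hm => by rw [hz m hm, map_zero, zero_mul]
    rwa [hf'0, sub_zero] at hmem
  · obtain ⟨h1, h2⟩ := h.mem_relModule.1 hmm
    refine Subtype.ext (funext fun l => ?_)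
    refine Fin.addCases (fun i => ?_) (fun j => ?_) l
    · rw [← m.2, ← m'.2, reducedExp_castAdd, reducedExp_castAdd]
      exact Int.emod_eq_emod_iff_emod_sub_eq_zero.2 (Int.emod_eq_zero_of_dvd (h1 i))
    · exact sub_eq_zero.1 (h2 j)

end Kernel

/-! ### The factorization of `τ` -/

section Factorization

variable {F : Type*} [Field F] {H : Type*} [CommRing H] [Algebra F H] {u s : ℕ}
  {σ : F ≃+* F} {τF : F →+* SeqRing (constField σ)} {σH : H ≃+* H}
  {x : Fin (u + s) → Hˣ} {α : Fin (u + s) → Fˣ} {τ : H →+* SeqRing (constField σ)}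
  {d : Fin u → ℕ} {n : ℕ} {ρ : constField σ} {ν : Fin u → ℕ} {g : Fin u → Fˣ}
  {c : Fin u → constField σ} {σE : tailRing F x ≃+* tailRing F x}

theorem tau_inv_eq {w : F} (hw : w ≠ 0) {y : Hˣ} {v v' : SeqRing (constField σ)}
    (hy : τ y = τ (algebraMap F H w) * v) (hv : v * v' = 1) :
    τ ((y⁻¹ : Hˣ) : H) = τ (algebraMap F H w⁻¹) * v' := by
  have h1 : τ ((y⁻¹ : Hˣ) : H) * τ y = 1 := by rw [← map_mul, Units.inv_mul, map_one]
  have h2 : τ (algebraMap F H w⁻¹) * τ (algebraMap F H w) = 1 := by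
    rw [← map_mul, ← map_mul, inv_mul_cancel₀ hw, map_one, map_one]
  rw [hy] at h1
  linear_combination (τ (algebraMap F H w⁻¹) * v') * h1 -
    τ ((y⁻¹ : Hˣ) : H) * v * v' * h2 - τ ((y⁻¹ : Hˣ) : H) * hv

theorem SpecialCase.exists_piFactorization (h : SpecialCase σ τF σH x α τ d)
    (hR : IsReduction σ x α τ d 1 ρ ν g c) (hE : TailStatement σ σH x α τ σE) :
    ∃ lam : H →+* tailRing F x, PiFactorization σ σH x α τ d σE g c lam := by
  have hρ : ρ = 1 := by simpa using hR.rho_pow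
  have hν : ∀ i, ν i = 0 := fun i => Nat.lt_one_iff.1 (hR.nu_lt i)
  have hcg : ∀ i, (c i : F) * g i ≠ 0 := fun i =>
    mul_ne_zero (by simpa using hR.c_ne_zero i) (g i).ne_zero
  have hgen : ∀ i, τ (x (Fin.castAdd s i)) = τ (algebraMap F H (c i * g i)) * 1 := fun i => by
    rw [hR.tau_gen, hρ, one_pow, map_one]
  have hinj := hE.isKEmbedding.injective
  obtain ⟨lam, hlam⟩ := exists_ringHom_lift hinj τ fun f => by
    refine h.isPExtension.map_mem τ (tailTau (F := F) x τ).range (fun a => ⟨algebraMap F _ a, rfl⟩)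
      (fun l => ?_) (fun l => ?_) f
    · refine Fin.addCases (fun i => ?_) (fun j => ?_) l
      · exact ⟨algebraMap F _ (c i * g i), by rw [hgen, mul_one]; rfl⟩
      · exact ⟨tailGen F x j, rfl⟩
    · refine Fin.addCases (fun i => ?_) (fun j => ?_) l
      · exact ⟨algebraMap F _ (c i * g i)⁻¹, by
          rw [tau_inv_eq (hcg i) (hgen i) (mul_one 1), mul_one]; rfl⟩
      · exact ⟨((tailGen F x j)⁻¹ : (tailRing F x)ˣ), rfl⟩
  have htail : ∀ e : tailRing F x, lam e = e := fun e => hinj (hlam e)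
  have hker : RingHom.ker τ = RingHom.ker lam := by
    ext f
    rw [RingHom.mem_ker, RingHom.mem_ker, ← hlam, map_eq_zero_iff _ hinj]
  exact ⟨lam,
    { shift_g := fun i => by simpa [hν, hρ] using hR.shift_g i
      c_ne_zero := hR.c_ne_zero
      lam_diffHom := fun f => hinj (by
        rw [hlam, h.isKHom.diffHom, hE.isKEmbedding.diffHom, hlam])
      lam_surjective := fun e => ⟨e, htail e⟩
      lam_tail := htail
      lam_gen := fun i => hinj (by rw [hlam, hgen, mul_one]; rfl)
      tau_lam := hlam
      ker_tau := hker
      ker_lam := hker ▸ h.ker_tau_eq_relIdeal hR }⟩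

end Factorization

section RootFactorization

variable {F : Type w} [Field F] {H : Type v} [CommRing H] [Algebra F H] {u s : ℕ}
  {σ : F ≃+* F} {τF : F →+* SeqRing (constField σ)} {σH : H ≃+* H}
  {x : Fin (u + s) → Hˣ} {α : Fin (u + s) → Fˣ} {τ : H →+* SeqRing (constField σ)}
  {d : Fin u → ℕ} {n : ℕ} {ρ : constField σ} {ν : Fin u → ℕ} {g : Fin u → Fˣ}
  {c : Fin u → constField σ} {σE : tailRing F x ≃+* tailRing F x}

theorem SpecialCase.orderOf_rho_nu (h : SpecialCase σ τF σH x α τ d)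
    (hR : IsReduction σ x α τ d n ρ ν g c) (i : Fin u) : orderOf (ρ ^ ν i) = d i :=
  h.orderOf_eq (g i).ne_zero (by rw [hR.shift_g, SubmonoidClass.coe_pow]) (hR.rho_nu_pow i)

theorem SpecialCase.orderOf_rho_sub (h : SpecialCase σ τF σH x α τ d)
    (hR : IsReduction σ x α τ d n ρ ν g c) (i : Fin u) : orderOf (ρ ^ (n - ν i)) = d i := by
  rw [← h.orderOf_rho_nu hR i, orderOf_eq_orderOf_iff]
  exact hR.rho_sub_pow_eq_one_iff i

theorem SpecialCase.orderOf_rho (h : SpecialCase σ τF σH x α τ d)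
    (hR : IsReduction σ x α τ d n ρ ν g c) {l : Fin u} (hl : d l = n) : orderOf ρ = n := by
  refine Nat.dvd_antisymm (orderOf_dvd_of_pow_eq_one hR.rho_pow) ?_
  rw [← hl, ← h.orderOf_rho_nu hR l]
  exact orderOf_pow_dvd _

/-- The sequence `(ρ^k)_k` is the image of a power of `(c_l g_l)⁻¹ x_l`. -/
theorem SpecialCase.exists_geomSeq_preimage (h : SpecialCase σ τF σH x α τ d)
    (hR : IsReduction σ x α τ d n ρ ν g c) {l : Fin u} (hl : d l = n) :
    ∃ (w : F) (k : ℕ), w ≠ 0 ∧ (ρ ^ (n - ν l)) ^ k = ρ ∧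
      τ (algebraMap F H w * (x (Fin.castAdd s l) : H) ^ k) = geomSeq _ ρ := by
  have hprim : IsPrimitiveRoot (ρ ^ (n - ν l)) n := by
    have := IsPrimitiveRoot.orderOf (ρ ^ (n - ν l))
    rwa [h.orderOf_rho_sub hR, hl] at this
  have : NeZero n := ⟨hl ▸ (h.d_pos l).ne'⟩
  obtain ⟨k, -, hk⟩ := hprim.eq_pow_of_pow_eq_one hR.rho_pow
  have hcg : (c l : F) * g l ≠ 0 := mul_ne_zero (by simpa using hR.c_ne_zero l) (g l).ne_zero
  refine ⟨((c l : F) * g l)⁻¹ ^ k, k, pow_ne_zero _ (inv_ne_zero hcg), hk, ?_⟩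
  rw [map_pow, ← mul_pow, map_pow, map_mul, hR.tau_gen, ← mul_assoc, ← map_mul, ← map_mul,
    inv_mul_cancel₀ hcg, map_one, map_one, one_mul, ← map_pow, hk]

theorem SpecialCase.ker_tau_map (h : SpecialCase σ τF σH x α τ d) :
    RingHom.ker τ = (RingHom.ker τ).map (σH : H →+* H) := by
  ext f
  change _ ↔ f ∈ Ideal.map σH (RingHom.ker τ)
  have hf : τ f = seqShift _ (τ (σH.symm f)) := by
    rw [← h.isKHom.diffHom, RingEquiv.apply_symm_apply]
  rw [← Ideal.comap_symm, Ideal.mem_comap, RingHom.mem_ker, RingHom.mem_ker, hf,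
    map_eq_zero_iff _ (seqShift (constField σ)).injective]

/-- Independence over the tail ring of the powers of an element `w x_l^k` representing
`(ρ^k)_k`. -/
theorem SpecialCase.tail_coeff_eq_zero (h : SpecialCase σ τF σH x α τ d)
    (hR : IsReduction σ x α τ d n ρ ν g c) {l : Fin u} (hl : d l = n) {w : F} (hw : w ≠ 0) {k : ℕ}
    (hk : (ρ ^ (n - ν l)) ^ k = ρ) (γ : Fin n → tailRing F x)
    (hγ : τ (∑ i, (γ i : H) * (algebraMap F H w * (x (Fin.castAdd s l) : H) ^ k) ^ (i : ℕ)) = 0) :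
    ∀ i, γ i = 0 := by
  classical
  choose f hf using fun i => exists_tail_sum (γ i)
  set T : Finset (Fin s → ℤ) := Finset.univ.biUnion fun i => (f i).support with hT
  have hsub : ∀ i, (f i).support ⊆ T := fun i => Finset.subset_biUnion_of_mem
    (fun i => (f i).support) (Finset.mem_univ i)
  have hγT : ∀ i, γ i = ∑ m ∈ T, f i m • laurentMonomial (tailGen F x) m := fun i => by
    rw [← hf i]
    exact Finsupp.sum_of_support_subset _ (hsub i) _ (by simp)
  let e : Fin n × (Fin s → ℤ) → Fin (u + s) → ℤ := fun p =>
    tailExp u p.2 + Pi.single (Fin.castAdd s l) ((k * (p.1 : ℕ) : ℕ) : ℤ)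
  have he : ∀ p q, e p - e q ∈ relModule σ α → p = q := by
    rintro ⟨i, m⟩ ⟨j, m'⟩ hpq
    obtain ⟨h1, h2⟩ := h.mem_relModule.1 hpq
    refine Prod.ext (Fin.ext ?_) (funext fun b => ?_)
    · have h3 := h1 l
      simp only [e, Pi.sub_apply, Pi.add_apply, tailExp_castAdd, Pi.single_eq_same, zero_add] at h3
      rw [← h.orderOf_rho_sub hR l, ← Nat.modEq_iff_dvd] at h3
      have h4 : ρ ^ (j : ℕ) = ρ ^ (i : ℕ) := by
        have : (ρ ^ (n - ν l)) ^ (k * (j : ℕ)) = (ρ ^ (n - ν l)) ^ (k * (i : ℕ)) := by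
          rw [← pow_mod_orderOf, h3, pow_mod_orderOf]
        rwa [pow_mul, pow_mul, hk] at this
      have hprim : IsPrimitiveRoot ρ n := by
        have := IsPrimitiveRoot.orderOf ρ
        rwa [h.orderOf_rho hR hl] at this
      exact (hprim.pow_inj j.2 i.2 h4).symm
    · have h3 := h2 b
      simpa [e, tailExp_natAdd, Pi.single_eq_of_ne (natAdd_ne_castAdd l b), sub_eq_zero] using h3
  have hz := h.tau_sum_eq_zero he (Finset.univ ×ˢ T) (fun p => f p.1 p.2 * w ^ (p.1 : ℕ)) ?_
  · intro i
    rw [hγT]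
    refine Finset.sum_eq_zero fun m hm => ?_
    have := hz (i, m) (Finset.mem_product.2 ⟨Finset.mem_univ _, hm⟩)
    rw [(mul_eq_zero.1 this).resolve_right (pow_ne_zero _ hw), zero_smul]
  · rw [← map_sum, ← hγ, Finset.sum_product]
    congr 1
    refine Finset.sum_congr rfl fun i _ => ?_
    rw [hγT, AddSubmonoidClass.coe_finsetSum, Finset.sum_mul]
    refine Finset.sum_congr rfl fun m _ => ?_
    rw [Subalgebra.coe_smul, coe_laurentMonomial_tailGen, Algebra.smul_def, ← laurentMonomial_add,
      laurentMonomial_tailExp, laurentMonomial_single, zpow_natCast, Units.val_pow_eq_pow_val,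
      mul_pow, ← pow_mul, map_mul, map_pow]
    ring

theorem SpecialCase.exists_rFactorization (h : SpecialCase σ τF σH x α τ d)
    (hR : IsReduction σ x α τ d n ρ ν g c) {l : Fin u} (hl : d l = n) (hn : 1 < n)
    (hE : TailStatement σ σH x α τ σE) :
    ∃ (B : Type v) (_ : CommRing B) (_ : Algebra (tailRing F x) B) (σB : B ≃+* B) (z : B)
      (τ' : B →+* SeqRing (constField σ)) (lam : H →+* B),
      RFactorization σ σH x α τ d n σE ρ ν g c σB z τ' lam := by
  obtain ⟨w, k, hw, hk, hZ⟩ := h.exists_geomSeq_preimage hR hl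
  obtain ⟨Z, hZdef⟩ : ∃ Z : H, Z = algebraMap F H w * (x (Fin.castAdd s l) : H) ^ k := ⟨_, rfl⟩
  rw [← hZdef] at hZ
  let π : H →+* H ⧸ RingHom.ker τ := Ideal.Quotient.mk (RingHom.ker τ)
  let τ' : H ⧸ RingHom.ker τ →+* SeqRing (constField σ) := RingHom.kerLift τ
  let σB : (H ⧸ RingHom.ker τ) ≃+* (H ⧸ RingHom.ker τ) :=
    Ideal.quotientEquiv (RingHom.ker τ) (RingHom.ker τ) σH h.ker_tau_map
  have hτ' : ∀ f, τ' (π f) = τ f := fun f => RingHom.kerLift_mk τ f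
  have hinj : Function.Injective τ' := RingHom.kerLift_injective τ
  have hσB : ∀ f, σB (π f) = π (σH f) := fun f => rfl
  have hz : τ' (π Z) = geomSeq _ ρ := (hτ' Z).trans hZ
  have hdiff : IsDiffHom σB (seqShift _) τ' := fun b => by
    obtain ⟨f, rfl⟩ := Ideal.Quotient.mk_surjective b
    exact (congrArg τ' (hσB f)).trans ((hτ' _).trans ((h.isKHom.diffHom f).trans
      (congrArg _ (hτ' f).symm)))
  have hcg : ∀ i, (c i : F) * g i ≠ 0 := fun i =>
    mul_ne_zero (by simpa using hR.c_ne_zero i) (g i).ne_zero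
  have hgen : ∀ i, π (x (Fin.castAdd s i)) = algebraMap (tailRing F x) (H ⧸ RingHom.ker τ)
      (algebraMap F (tailRing F x) (c i * g i)) * π Z ^ (n - ν i) := fun i => hinj (by
    rw [map_mul, map_pow, hz, ← map_pow, hτ', hR.tau_gen]
    exact congrArg (· * _) (hτ' _).symm)
  have hgen_inv : ∀ i, π ((x (Fin.castAdd s i))⁻¹ : Hˣ) =
      algebraMap (tailRing F x) (H ⧸ RingHom.ker τ)
        (algebraMap F (tailRing F x) (c i * g i)⁻¹) * π Z ^ ν i := fun i => hinj (by
    rw [map_mul, map_pow, hz, ← map_pow, hτ', tau_inv_eq (hcg i) (hR.tau_gen i)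
      (v' := geomSeq _ (ρ ^ ν i)) (by rw [← map_mul, hR.rho_sub_mul, map_one])]
    exact congrArg (· * _) (hτ' _).symm)
  have hpow : π Z ^ n = 1 := hinj (by rw [map_pow, hz, ← map_pow, hR.rho_pow, map_one, map_one])
  have hemb : IsKEmbedding σB ((algebraMap (tailRing F x) (H ⧸ RingHom.ker τ)).comp
      (constIncl σ (tailRing F x))) τ' :=
    { diffHom := hdiff
      const := fun a => (hτ' _).trans (h.tau_const a)
      injective := hinj }
  have hadjoin : ∀ f, π f ∈ (Algebra.adjoin (tailRing F x) {π Z}).toSubring := by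
    have hzmem : ∀ m : ℕ, π Z ^ m ∈ Algebra.adjoin (tailRing F x) {π Z} := fun m =>
      Subalgebra.pow_mem _ (Algebra.self_mem_adjoin_singleton _ _) m
    refine h.isPExtension.map_mem π _
      (fun a => Subalgebra.algebraMap_mem _ (algebraMap F (tailRing F x) a))
      (fun j => ?_) (fun j => ?_)
    · refine Fin.addCases (fun i => ?_) (fun j => ?_) j
      · rw [hgen]
        exact Subalgebra.mul_mem _ (Subalgebra.algebraMap_mem _ _) (hzmem _)
      · exact Subalgebra.algebraMap_mem _ (tailGen F x j : tailRing F x)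
    · refine Fin.addCases (fun i => ?_) (fun j => ?_) j
      · rw [hgen_inv]
        exact Subalgebra.mul_mem _ (Subalgebra.algebraMap_mem _ _) (hzmem _)
      · exact Subalgebra.algebraMap_mem _ (((tailGen F x j)⁻¹ : (tailRing F x)ˣ) : tailRing F x)
  have hspan : Submodule.span (tailRing F x) (Set.range fun i : Fin n => π Z ^ (i : ℕ)) = ⊤ := by
    rw [eq_top_iff]
    rintro b -
    obtain ⟨f, rfl⟩ := Ideal.Quotient.mk_surjective b
    have hf : π f ∈ Subalgebra.toSubmodule (Algebra.adjoin (tailRing F x) {π Z}) := hadjoin f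
    rw [Algebra.adjoin_eq_span] at hf
    refine Submodule.span_mono ?_ hf
    intro y hy
    obtain ⟨m, rfl⟩ := Submonoid.mem_closure_singleton.1 hy
    exact ⟨⟨m % n, Nat.mod_lt _ (zero_lt_one.trans hn)⟩, (pow_eq_pow_mod m hpow).symm⟩
  have hind : LinearIndependent (tailRing F x) fun i : Fin n => π Z ^ (i : ℕ) := by
    refine Fintype.linearIndependent_iff.2 fun γ hγ => h.tail_coeff_eq_zero hR hl hw hk γ ?_
    rw [← hZdef, ← hτ', map_sum, ← map_zero τ', ← hγ]
    congr 1
  refine ⟨H ⧸ RingHom.ker τ, inferInstance, inferInstance, σB, π Z, τ', π,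
    { isRExtension :=
        { one_lt := hn
          extends_aut := fun e => (hσB _).trans (congrArg π (hE.restrict_aut e).symm)
          pow_eq_one := hpow
          linearIndependent := hind
          span_eq_top := hspan
          root_pow := by rw [← map_pow, hR.rho_pow, map_one]
          shift_gen := hinj (by
            rw [hdiff, map_mul τ', hz, seqShift_geomSeq]
            exact congrArg (· * _) (hemb.const ρ).symm)
          noNewConstants := fun b hb => by
            obtain ⟨a, ha⟩ := hemb.exists_const hb
            refine ⟨constIncl σ (tailRing F x) a, ?_, ha⟩
            exact (hE.isPiExtension.extends_aut _).trans (congrArg _ (constField_apply a)) }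
      tau'_isKEmbedding := hemb
      tau'_tail := fun e => hτ' _
      tau'_z := hz
      nu_lt := hR.nu_lt
      shift_g := hR.shift_g
      order_z := fun i => ?_
      order_rho := fun i => ⟨h.orderOf_rho_nu hR i, h.orderOf_rho_sub hR i⟩
      c_ne_zero := hR.c_ne_zero
      lam_diffHom := fun f => (hσB f).symm
      lam_surjective := Ideal.Quotient.mk_surjective
      lam_tail := fun e => rfl
      lam_gen := fun i => by
        rw [hgen, map_mul, map_mul]
        ring
      tau_lam := hτ'
      ker_tau := (Ideal.mk_ker).symm
      ker_lam := (Ideal.mk_ker).trans (h.ker_tau_eq_relIdeal hR) }⟩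
  have hord : ∀ m, orderOf (π Z ^ m) = orderOf (ρ ^ m) := fun m => by
    rw [← orderOf_injective (τ' : (H ⧸ RingHom.ker τ) →* SeqRing (constField σ)) hinj,
      ← orderOf_injective (geomSeq (constField σ)) geomSeq_injective (ρ ^ m), map_pow, map_pow]
    exact congrArg (fun y => orderOf (y ^ m)) hz
  exact ⟨(hord _).trans (h.orderOf_rho_nu hR i), (hord _).trans (h.orderOf_rho_sub hR i)⟩

end RootFactorization

/-! ### Computability of the factorization maps -/

section ComputableFactorization

variable {F : Type w} [Field F] [Primcodable F] {H : Type v} [CommRing H] [Algebra F H] {u s : ℕ}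
  {σ : F ≃+* F} {σH : H ≃+* H} {x : Fin (u + s) → Hˣ} {α : Fin (u + s) → Fˣ}
  {τ : H →+* SeqRing (constField σ)} {d : Fin u → ℕ} {n : ℕ} {ρ : constField σ} {ν : Fin u → ℕ}
  {g : Fin u → Fˣ} {c : Fin u → constField σ} {σE : tailRing F x ≃+* tailRing F x}

theorem PiFactorization.computableVia {lam : H →+* tailRing F x}
    (h : PiFactorization σ σH x α τ d σE g c lam) (hF : IsComputableDiffField σ) :
    ComputableVia (laurentRep (F := F) x) (laurentRep (F := F) (tailGen F x)) lam := by
  let G : Fin u → Fˣ := fun i => Units.mk0 (c i : F) (by simpa using h.c_ne_zero i) * g i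
  refine computableVia_termRep hF id Computable.id lam (fun a => h.lam_tail (algebraMap F _ a))
    (χ := fun m => ∏ i, (G i : F) ^ m (Fin.castAdd s i))
    (computable_prod_zpow hF _ _) (p := fun m j => m (Fin.natAdd u j))
    (Primrec.int_fun_reindex _).to_comp fun m => ?_
  rw [laurentMonomial_split, map_mul, map_laurentMonomial lam, map_laurentMonomial lam,
    ← laurentMonomial_units_eq G fun i => m (Fin.castAdd s i),
    map_laurentMonomial (algebraMap F (tailRing F x))]
  have h1 : (fun i => Units.map (lam : H →* tailRing F x) (x (Fin.castAdd s i))) =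
      fun i => Units.map (algebraMap F (tailRing F x) : F →* tailRing F x) (G i) :=
    funext fun i => Units.ext (h.lam_gen i)
  have h2 : (fun j => Units.map (lam : H →* tailRing F x) (x (Fin.natAdd u j))) = tailGen F x :=
    funext fun j => Units.ext (h.lam_tail (tailGen F x j))
  rw [h1, h2]

theorem units_pow_sub_zpow {B : Type*} [Monoid B] {z : Bˣ} {n e : ℕ} (hz : z ^ n = 1) (he : e ≤ n)
    (m : ℤ) : (z ^ (n - e)) ^ m = z ^ ((n - e) * m.toNat + e * (-m).toNat) := by
  have hinv : (z ^ (n - e))⁻¹ = z ^ e := by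
    rw [inv_eq_iff_mul_eq_one, ← pow_add, Nat.sub_add_cancel he, hz]
  rcases m with m | m
  · simp [pow_mul]
  · rw [zpow_negSucc, ← inv_pow, hinv, ← pow_mul]
    simp

theorem RFactorization.computableVia {B : Type*} [CommRing B] [Algebra (tailRing F x) B]
    {σB : B ≃+* B} {z : B} {τ' : B →+* SeqRing (constField σ)} {lam : H →+* B}
    (h : RFactorization σ σH x α τ d n σE ρ ν g c σB z τ' lam) (hF : IsComputableDiffField σ) :
    ComputableVia (laurentRep (F := F) x) (laurentRootRep (F := F) (tailGen F x) z) lam := by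
  let G : Fin u → Fˣ := fun i => Units.mk0 (c i : F) (by simpa using h.c_ne_zero i) * g i
  let ι : F →+* B := (algebraMap (tailRing F x) B).comp (algebraMap F (tailRing F x))
  have hn : n ≠ 0 := (zero_lt_one.trans h.isRExtension.one_lt).ne'
  let zu : Bˣ := Units.ofPowEqOne z n h.isRExtension.pow_eq_one hn
  have hzu : zu ^ n = 1 := Units.pow_ofPowEqOne _ _
  let E : (Fin (u + s) → ℤ) → ℕ := fun m => ∑ i : Fin u,
    ((n - ν i) * (m (Fin.castAdd s i)).toNat + ν i * (-m (Fin.castAdd s i)).toNat)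
  have hE : Computable E := Computable.sum_finset_nat _ fun i =>
    Primrec.nat_add.to_comp.comp
      (Primrec.nat_mul.to_comp.comp (Computable.const _)
        (Primrec.int_toNat.to_comp.comp (Primrec.int_fun_apply (Fin.castAdd s i)).to_comp))
      (Primrec.nat_mul.to_comp.comp (Computable.const _)
        (Primrec.int_toNat_neg.to_comp.comp (Primrec.int_fun_apply (Fin.castAdd s i)).to_comp))
  rw [laurentRootRep_eq_termRep]
  refine computableVia_termRep hF id Computable.id lam (fun a => h.lam_tail (algebraMap F _ a))
    (χ := fun m => ∏ i, (G i : F) ^ m (Fin.castAdd s i))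
    (computable_prod_zpow hF _ _) (p := fun m => (fun j => m (Fin.natAdd u j), E m))
    ((Primrec.int_fun_reindex _).to_comp.pair hE) fun m => ?_
  have h1 : (fun i => Units.map (lam : H →* B) (x (Fin.castAdd s i))) =
      fun i => Units.map (ι : F →* B) (G i) * zu ^ (n - ν i) := by
    funext i
    refine Units.ext ((h.lam_gen i).trans ?_)
    simp only [Units.val_mul, Units.val_pow_eq_pow_val, Units.coe_map, G, MonoidHom.coe_coe, map_mul,
      Units.val_mk0]
    change _ = _ * _ * z ^ (n - ν i)
    simp only [ι, RingHom.comp_apply]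
    ring
  have h2 : (fun j => Units.map (lam : H →* B) (x (Fin.natAdd u j))) =
      fun j => Units.map (algebraMap (tailRing F x) B : _ →* B) (tailGen F x j) :=
    funext fun j => Units.ext (h.lam_tail (tailGen F x j))
  have h3 : laurentMonomial (fun i => zu ^ (n - ν i)) (fun i => m (Fin.castAdd s i)) = z ^ E m := by
    rw [laurentMonomial, Finset.prod_congr rfl fun i _ =>
      units_pow_sub_zpow hzu (h.nu_lt i).le (m (Fin.castAdd s i)), Finset.prod_pow_eq_pow_sum]
    rfl
  rw [laurentMonomial_split, map_mul, map_laurentMonomial lam, map_laurentMonomial lam, h1, h2,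
    laurentMonomial_mul, h3, ← map_laurentMonomial (algebraMap (tailRing F x) B),
    ← map_laurentMonomial ι, ← laurentMonomial_units_eq G fun i => m (Fin.castAdd s i)]
  change _ = ι _ * (_ * _)
  ring

end ComputableFactorization

/-! ### Evaluation -/

section Evaluation

variable {F : Type w} [Field F] {σ : F ≃+* F} {ev : F → ℕ → constField σ} {L : F → ℕ}

theorem IsOSigmaFunction.ev_shift (hL : IsOSigmaFunction σ ev L) {f : F} {k : ℕ} (hk : L f ≤ k) :
    ev (σ f) k = ev f (k + 1) := by
  have := hL.shift f 1 k (by simpa using hk)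
  simpa using this

theorem IsOSigmaFunction.ev_const (hL : IsOSigmaFunction σ ev L) (hev : IsEvaluation σ ev)
    (c : constField σ) {k : ℕ} (hk : L c ≤ k) : ev c k = c := by
  have hstep : ∀ j, ev c (k + j) = ev c k := by
    intro j
    induction j with
    | zero => rfl
    | succ j ih =>
      rw [← ih, ← Nat.add_assoc, ← hL.ev_shift (hk.trans (Nat.le_add_right k j)), constField_apply]
  obtain ⟨N, hN⟩ := eventually_atTop.1 (hev.const c)
  rw [← hstep N]
  exact hN _ (Nat.le_add_left N k)

/-- The conditions on a candidate `(g, e, c)` for a generator with `τ(x) = (κ ∏_{l ≤ k < m} ev(α, k))_m`: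
`σ g = ρ^e α g`, `(ρ^e)^d = 1`, and `τ(x)` agrees with `c g (ρ^(n-e))^m` at `N`, where `N` is so large
that both sequences obey the same recurrence from `N` on. -/
structure CandidateCheck (σ : F ≃+* F) (ev : F → ℕ → constField σ) (L : F → ℕ) (N n : ℕ) (ρ : F)
    (a κ : F) (l d : ℕ) (g : F) (e : ℕ) (c : F) : Prop where
  c_const : σ c = c
  c_ne_zero : c ≠ 0
  g_ne_zero : g ≠ 0
  lt : e < n
  shift_g : σ g = ρ ^ e * a * g
  pow_eq_one : (ρ ^ e) ^ d = 1
  l_le : l ≤ N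
  g_le : L g ≤ N
  mul_le : L (ρ ^ e * a) ≤ N
  pow_le : L (ρ ^ e) ≤ N
  a_le : L a ≤ N
  eval_eq : κ * ∏ k ∈ Finset.Ico l N, (ev a k : F) = c * ev g N * (ρ ^ (n - e)) ^ N

theorem eval_step (hL : IsOSigmaFunction σ ev L) (hev : IsEvaluation σ ev) {n e N : ℕ} (he : e ≤ n)
    {ρ : constField σ} (hρ : ρ ^ n = 1) {a g : F} (hg : σ g = (ρ : F) ^ e * a * g) (hg' : L g ≤ N)
    (hm : L ((ρ : F) ^ e * a) ≤ N) (hp : L ((ρ : F) ^ e) ≤ N) (ha : L a ≤ N) :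
    ev g (N + 1) * (ρ ^ (n - e)) ^ (N + 1) = ev g N * (ρ ^ (n - e)) ^ N * ev a N := by
  have h1 : ev ((ρ : F) ^ e) N = ρ ^ e := by
    have := hL.ev_const hev (ρ ^ e) (k := N) (by simpa using hp)
    simpa using this
  have h2 : ρ ^ e * ρ ^ (n - e) = 1 := by rw [← pow_add, Nat.add_sub_cancel' he, hρ]
  rw [← hL.ev_shift hg', hg, hL.mul _ _ _ (max_le hm hg'), hL.mul _ _ _ (max_le hp ha), h1, pow_succ]
  linear_combination ev a N * ev g N * (ρ ^ (n - e)) ^ N * h2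

theorem CandidateCheck.toSeq_eq (hL : IsOSigmaFunction σ ev L) (hev : IsEvaluation σ ev)
    {N n l d e : ℕ} {ρ κ c : constField σ} {a g : F} (hρ : ρ ^ n = 1)
    (h : CandidateCheck σ ev L N n ρ a κ l d g e c) :
    (toSeq fun m => κ * ∏ k ∈ Finset.Ico l m, ev a k) =
      toSeq fun m => c * ev g m * (ρ ^ (n - e)) ^ m := by
  refine Germ.coe_eq.2 (eventually_atTop.2 ⟨N, fun m hm => ?_⟩)
  induction m, hm using Nat.le_induction with
  | base => exact Subtype.ext (by simpa using h.eval_eq)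
  | succ m hm ih =>
    beta_reduce at ih ⊢
    rw [Finset.prod_Ico_succ_top (h.l_le.trans hm), ← mul_assoc, ih]
    linear_combination (-c) * eval_step hL hev h.lt.le hρ h.shift_g (h.g_le.trans hm)
      (h.mul_le.trans hm) (h.pow_le.trans hm) (h.a_le.trans hm)

end Evaluation

/-! ### The algorithm -/

section Algorithm

variable {F : Type w} [Field F] {σ : F ≃+* F}

/-- The conditions on a candidate output `ρ`, `[(gᵢ, νᵢ, cᵢ)]` and an evaluation point `N`, for the
input `[(αᵢ, κᵢ, lᵢ)]`, `[dᵢ]`. -/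
structure OutputCheck (σ : F ≃+* F) (ev : F → ℕ → constField σ) (L : F → ℕ)
    (inp : List (F × F × ℕ) × List ℕ) (out : ℕ × F × List (F × ℕ × F)) : Prop where
  length_eq : out.2.2.length = inp.2.length
  rho_const : σ out.2.1 = out.2.1
  rho_pow : out.2.1 ^ inp.2.getD (inp.2.length - 1) 0 = 1
  candidate : ∀ i < inp.2.length, CandidateCheck σ ev L out.1 (inp.2.getD (inp.2.length - 1) 0)
    out.2.1 (inp.1.getD i (0, 0, 0)).1 (inp.1.getD i (0, 0, 0)).2.1 (inp.1.getD i (0, 0, 0)).2.2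
    (inp.2.getD i 0) (out.2.2.getD i (0, 0, 0)).1 (out.2.2.getD i (0, 0, 0)).2.1
    (out.2.2.getD i (0, 0, 0)).2.2

theorem computablePred_candidateCheck [Primcodable F] {ev : F → ℕ → constField σ} {L Z : F → ℕ}
    {τF : F →+* SeqRing (constField σ)} (hF : IsComputableDiffField σ)
    (hO : IsOSigmaComputable σ τF ev L Z) {A : Type*} [Primcodable A] {N n l d e : A → ℕ}
    {ρ a κ g c : A → F} (hN : Computable N) (hn : Computable n) (hl : Computable l)
    (hd : Computable d) (he : Computable e) (hρ : Computable ρ) (ha : Computable a)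
    (hκ : Computable κ) (hg : Computable g) (hc : Computable c) :
    ComputablePred fun q =>
      CandidateCheck σ ev L (N q) (n q) (ρ q) (a q) (κ q) (l q) (d q) (g q) (e q) (c q) := by
  have hpow : Computable fun q => ρ q ^ e q := Computable.pow_of_mul hF.mul hρ he
  have hpa : Computable fun q => ρ q ^ e q * a q := hF.mul.comp hpow ha
  have hprod : Computable fun q => ∏ k ∈ Finset.Ico (l q) (N q), (ev (a q) k : F) := by
    refine (Computable.prod_range (f := fun q k => (ev (a q) (l q + k) : F)) hF.mul
      (Primrec.nat_sub.to_comp.comp hN hl) ?_).of_eq fun q =>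
        (Finset.prod_Ico_eq_prod_range (fun k => (ev (a q) k : F)) _ _).symm
    exact hO.computable_ev.comp (ha.comp .fst)
      (Primrec.nat_add.to_comp.comp (hl.comp .fst) .snd)
  have hrhs : Computable fun q => c q * ev (g q) (N q) * (ρ q ^ (n q - e q)) ^ N q :=
    hF.mul.comp (hF.mul.comp hc (hO.computable_ev.comp hg hN))
      (Computable.pow_of_mul hF.mul
        (Computable.pow_of_mul hF.mul hρ (Primrec.nat_sub.to_comp.comp hn he)) hN)
  refine ((ComputablePred.eq_apply (hF.aut.comp hc) hc).and_pred
    ((ComputablePred.ne_apply hc (Computable.const 0)).and_pred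
    ((ComputablePred.ne_apply hg (Computable.const 0)).and_pred
    ((ComputablePred.lt_apply he hn).and_pred
    ((ComputablePred.eq_apply (hF.aut.comp hg) (hF.mul.comp hpa hg)).and_pred
    ((ComputablePred.eq_apply (Computable.pow_of_mul hF.mul hpow hd) (Computable.const 1)).and_pred
    ((ComputablePred.le_apply hl hN).and_pred
    ((ComputablePred.le_apply (hO.computable_L.comp hg) hN).and_pred
    ((ComputablePred.le_apply (hO.computable_L.comp hpa) hN).and_pred
    ((ComputablePred.le_apply (hO.computable_L.comp hpow) hN).and_pred
    ((ComputablePred.le_apply (hO.computable_L.comp ha) hN).and_pred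
    (ComputablePred.eq_apply (hF.mul.comp hκ hprod) hrhs)))))))))))).of_eq fun q => ?_
  exact ⟨fun ⟨h1, h2, h3, h4, h5, h6, h7, h8, h9, h10, h11, h12⟩ =>
      ⟨h1, h2, h3, h4, h5, h6, h7, h8, h9, h10, h11, h12⟩,
    fun ⟨h1, h2, h3, h4, h5, h6, h7, h8, h9, h10, h11, h12⟩ =>
      ⟨h1, h2, h3, h4, h5, h6, h7, h8, h9, h10, h11, h12⟩⟩

theorem computablePred_outputCheck [Primcodable F] {ev : F → ℕ → constField σ} {L Z : F → ℕ}
    {τF : F →+* SeqRing (constField σ)} (hF : IsComputableDiffField σ)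
    (hO : IsOSigmaComputable σ τF ev L Z) :
    ComputablePred fun q : (List (F × F × ℕ) × List ℕ) × (ℕ × F × List (F × ℕ × F)) =>
      OutputCheck σ ev L q.1 q.2 := by
  have hD : Computable fun q : (List (F × F × ℕ) × List ℕ) × (ℕ × F × List (F × ℕ × F)) => q.1.2 :=
    Computable.snd.comp .fst
  have hlen := Computable.list_length.comp hD
  have hN : Computable fun q : (List (F × F × ℕ) × List ℕ) × (ℕ × F × List (F × ℕ × F)) => q.2.1 :=
    Computable.fst.comp .snd
  have hρ : Computable fun q : (List (F × F × ℕ) × List ℕ) × (ℕ × F × List (F × ℕ × F)) => q.2.2.1 :=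
    Computable.fst.comp (Computable.snd.comp .snd)
  have hT : Computable fun q : (List (F × F × ℕ) × List ℕ) × (ℕ × F × List (F × ℕ × F)) => q.2.2.2 :=
    Computable.snd.comp (Computable.snd.comp .snd)
  have hn : Computable fun q : (List (F × F × ℕ) × List ℕ) × (ℕ × F × List (F × ℕ × F)) =>
      q.1.2.getD (q.1.2.length - 1) 0 :=
    (Primrec.list_getD 0).to_comp.comp hD (Computable.pred.comp hlen)
  have hAi : Computable fun p : ((List (F × F × ℕ) × List ℕ) × (ℕ × F × List (F × ℕ × F))) × ℕ =>
      p.1.1.1.getD p.2 (0, 0, 0) :=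
    (Primrec.list_getD _).to_comp.comp (Computable.fst.comp (Computable.fst.comp .fst)) .snd
  have hDi : Computable fun p : ((List (F × F × ℕ) × List ℕ) × (ℕ × F × List (F × ℕ × F))) × ℕ =>
      p.1.1.2.getD p.2 0 := (Primrec.list_getD _).to_comp.comp (hD.comp .fst) .snd
  have hTi : Computable fun p : ((List (F × F × ℕ) × List ℕ) × (ℕ × F × List (F × ℕ × F))) × ℕ =>
      p.1.2.2.2.getD p.2 (0, 0, 0) := (Primrec.list_getD _).to_comp.comp (hT.comp .fst) .snd
  have hcand := ComputablePred.forall_lt (p := fun q i => CandidateCheck σ ev L q.2.1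
    (q.1.2.getD (q.1.2.length - 1) 0) q.2.2.1 (q.1.1.getD i (0, 0, 0)).1
    (q.1.1.getD i (0, 0, 0)).2.1 (q.1.1.getD i (0, 0, 0)).2.2 (q.1.2.getD i 0)
    (q.2.2.2.getD i (0, 0, 0)).1 (q.2.2.2.getD i (0, 0, 0)).2.1 (q.2.2.2.getD i (0, 0, 0)).2.2)
    hlen (computablePred_candidateCheck hF hO (hN.comp .fst)
    (hn.comp .fst) (Computable.snd.comp (Computable.snd.comp hAi)) hDi
    (Computable.fst.comp (Computable.snd.comp hTi)) (hρ.comp .fst) (Computable.fst.comp hAi)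
    (Computable.fst.comp (Computable.snd.comp hAi)) (Computable.fst.comp hTi)
    (Computable.snd.comp (Computable.snd.comp hTi)))
  refine ((ComputablePred.eq_apply (Computable.list_length.comp hT) hlen).and_pred
    ((ComputablePred.eq_apply (hF.aut.comp hρ) hρ).and_pred
    ((ComputablePred.eq_apply (Computable.pow_of_mul hF.mul hρ hn) (Computable.const 1)).and_pred
    hcand))).of_eq fun q => ?_
  exact ⟨fun ⟨h1, h2, h3, h4⟩ => ⟨h1, h2, h3, h4⟩, fun ⟨h1, h2, h3, h4⟩ => ⟨h1, h2, h3, h4⟩⟩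

variable {H : Type v} [CommRing H] [Algebra F H] {u s : ℕ}
  {τF : F →+* SeqRing (constField σ)} {σH : H ≃+* H} {ev : F → ℕ → constField σ} {L : F → ℕ}
  {x : Fin (u + s) → Hˣ} {α : Fin (u + s) → Fˣ} {τ : H →+* SeqRing (constField σ)}
  {d : Fin u → ℕ} {κ : Fin (u + s) → constField σ} {l : Fin (u + s) → ℕ}

/-- The input of the algorithm. -/
def algoInput (α : Fin (u + s) → Fˣ) (κ : Fin (u + s) → constField σ) (l : Fin (u + s) → ℕ)
    (d : Fin u → ℕ) : List (F × F × ℕ) × List ℕ :=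
  (List.ofFn fun i => ((α i : F), (κ i : F), l i), List.ofFn d)

theorem List.getD_ofFn {β : Type*} {k : ℕ} (f : Fin k → β) (b : β) (i : Fin k) :
    (List.ofFn f).getD i b = f i := by
  simp [List.getD_eq_getElem?_getD]

theorem algoInput_last (hu : 0 < u) :
    (algoInput α κ l d).2.getD ((algoInput α κ l d).2.length - 1) 0 = lastEntry hu d := by
  have : (algoInput α κ l d).2.length - 1 = (⟨u - 1, Nat.sub_one_lt_of_lt hu⟩ : Fin u) := by
    simp [algoInput]
  rw [this]
  exact List.getD_ofFn d 0 _

theorem algoInput_fst (i : Fin u) : (algoInput α κ l d).1.getD i (0, 0, 0) =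
    ((α (Fin.castAdd s i) : F), (κ (Fin.castAdd s i) : F), l (Fin.castAdd s i)) :=
  List.getD_ofFn (fun i => ((α i : F), (κ i : F), l i)) (0, 0, 0) (Fin.castAdd s i)

theorem SpecialCase.tau_candidate (h : SpecialCase σ τF σH x α τ d)
    (htau : ∀ f, τF f = toSeq (ev f)) (c b : constField σ) (g : F) :
    τ (algebraMap F H (c * g)) * geomSeq _ b = toSeq fun m => c * ev g m * b ^ m := by
  rw [map_mul, map_mul, h.tau_const, h.restrict, htau]
  rfl

theorem SpecialCase.exists_outputCheck (h : SpecialCase σ τF σH x α τ d)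
    (htau : ∀ f, τF f = toSeq (ev f)) (hσ : RadicalStable σ) (hu : 0 < u)
    (hx : ∀ i, τ (x i) = toSeq fun m => κ i * ∏ k ∈ Finset.Ico (l i) m, ev (α i) k) :
    ∃ out, OutputCheck σ ev L (algoInput α κ l d) out := by
  obtain ⟨ρ, ν, g, c, hR⟩ := h.exists_isReduction hσ hu
  have hev : ∀ᶠ N in atTop, ∀ i, CandidateCheck σ ev L N (lastEntry hu d) ρ
      (α (Fin.castAdd s i)) (κ (Fin.castAdd s i)) (l (Fin.castAdd s i)) (d i) (g i) (ν i) (c i) := by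
    refine eventually_all.2 fun i => ?_
    have heq := hR.tau_gen i
    rw [h.tau_candidate htau, hx] at heq
    filter_upwards [Germ.coe_eq.1 heq, eventually_ge_atTop (l (Fin.castAdd s i)),
      eventually_ge_atTop (L (g i)), eventually_ge_atTop (L ((ρ : F) ^ ν i * α (Fin.castAdd s i))),
      eventually_ge_atTop (L ((ρ : F) ^ ν i)), eventually_ge_atTop (L (α (Fin.castAdd s i)))]
      with N h1 h2 h3 h4 h5 h6
    exact
      { c_const := constField_apply _
        c_ne_zero := by simpa using hR.c_ne_zero i
        g_ne_zero := (g i).ne_zero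
        lt := hR.nu_lt i
        shift_g := hR.shift_g i
        pow_eq_one := by simpa using congrArg Subtype.val (hR.rho_nu_pow i)
        l_le := h2
        g_le := h3
        mul_le := h4
        pow_le := h5
        a_le := h6
        eval_eq := by simpa using congrArg Subtype.val h1 }
  obtain ⟨N, hN⟩ := hev.exists
  refine ⟨(N, ρ, List.ofFn fun i => ((g i : F), ν i, (c i : F))), ?_, constField_apply ρ, ?_, ?_⟩
  · simp [algoInput]
  · rw [algoInput_last hu]
    simpa using congrArg Subtype.val hR.rho_pow
  · intro i hi
    obtain ⟨i, rfl⟩ : ∃ j : Fin u, (j : ℕ) = i := ⟨⟨i, by simpa [algoInput] using hi⟩, rfl⟩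
    rw [algoInput_last hu, algoInput_fst, List.getD_ofFn]
    have : (algoInput α κ l d).2.getD i 0 = d i := List.getD_ofFn d 0 i
    rw [this]
    exact hN i

theorem SpecialCase.isReduction_of_outputCheck (h : SpecialCase σ τF σH x α τ d)
    (htau : ∀ f, τF f = toSeq (ev f)) (hL : IsOSigmaFunction σ ev L) (hev : IsEvaluation σ ev)
    (hu : 0 < u)
    (hx : ∀ i, τ (x i) = toSeq fun m => κ i * ∏ k ∈ Finset.Ico (l i) m, ev (α i) k)
    {out : ℕ × F × List (F × ℕ × F)} (hout : OutputCheck σ ev L (algoInput α κ l d) out) :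
    ∃ (ρ : constField σ) (ν : Fin u → ℕ) (g : Fin u → Fˣ) (c : Fin u → constField σ),
      ((ρ : F), List.ofFn fun i => ((g i : F), ν i, (c i : F))) = out.2 ∧
        IsReduction σ x α τ d (lastEntry hu d) ρ ν g c := by
  have hlen : out.2.2.length = u := by simpa [algoInput] using hout.length_eq
  have hcand : ∀ i : Fin u, CandidateCheck σ ev L out.1 (lastEntry hu d) out.2.1
      (α (Fin.castAdd s i)) (κ (Fin.castAdd s i)) (l (Fin.castAdd s i)) (d i)
      (out.2.2.getD i (0, 0, 0)).1 (out.2.2.getD i (0, 0, 0)).2.1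
      (out.2.2.getD i (0, 0, 0)).2.2 := by
    intro i
    have := hout.candidate i (by simp [algoInput])
    rw [algoInput_last hu, algoInput_fst] at this
    have hd : (algoInput α κ l d).2.getD i 0 = d i := List.getD_ofFn d 0 i
    rwa [hd] at this
  let ρ : constField σ := ⟨out.2.1, hout.rho_const⟩
  let g : Fin u → Fˣ := fun i => Units.mk0 _ (hcand i).g_ne_zero
  let ν : Fin u → ℕ := fun i => (out.2.2.getD i (0, 0, 0)).2.1
  let c : Fin u → constField σ := fun i => ⟨_, (hcand i).c_const⟩
  have hρ : ρ ^ lastEntry hu d = 1 := Subtype.ext (by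
    have := hout.rho_pow
    rw [algoInput_last hu] at this
    simpa using this)
  refine ⟨ρ, ν, g, c, Prod.ext rfl ?_, hρ, fun i => (hcand i).lt, fun i => (hcand i).shift_g,
    fun i => Subtype.ext (hcand i).pow_eq_one, fun i h0 => (hcand i).c_ne_zero
      (congrArg Subtype.val h0), fun i => ?_⟩
  · refine List.ext_getElem (by simp [hlen]) fun i h1 h2 => ?_
    simp [g, ν, c, List.getElem?_eq_getElem h2]
  · rw [h.tau_candidate htau, hx]
    exact CandidateCheck.toSeq_eq hL hev hρ (hcand i)

end Algorithm

theorem mainTheorem3 {F : Type w} [Field F] [CharZero F] (σ : F ≃+* F)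
    (hσ : RadicalStable σ) (τF : F →+* SeqRing (constField σ))
    (hτF : IsKEmbedding σ (constIncl σ F) τF) :
    -- the structural part
    (∀ (u s : ℕ) (hu : 0 < u) (H : Type v) [CommRing H] [Algebra F H] (σH : H ≃+* H)
      (x : Fin (u + s) → Hˣ) (α : Fin (u + s) → Fˣ) (τ : H →+* SeqRing (constField σ))
      (d : Fin u → ℕ), SpecialCase σ τF σH x α τ d →
      ∃ σE : tailRing F x ≃+* tailRing F x, TailStatement σ σH x α τ σE ∧
        (lastEntry hu d = 1 →
          ∃ (g : Fin u → Fˣ) (c : Fin u → constField σ) (lam : H →+* tailRing F x),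
            PiFactorization σ σH x α τ d σE g c lam) ∧
        (lastEntry hu d ≠ 1 → 1 < lastEntry hu d ∧
          ∃ (ρ : constField σ) (ν : Fin u → ℕ) (g : Fin u → Fˣ) (c : Fin u → constField σ)
            (B : Type v) (_ : CommRing B) (_ : Algebra (tailRing F x) B) (σB : B ≃+* B) (z : B)
            (τ' : B →+* SeqRing (constField σ)) (lam : H →+* B),
            RFactorization σ σH x α τ d (lastEntry hu d) σE ρ ν g c σB z τ' lam)) ∧
    -- the algorithmic part
    (∀ [Primcodable F] (ev : F → ℕ → constField σ) (L Z : F → ℕ),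
      IsComputableDiffField σ → IsOSigmaComputable σ τF ev L Z → CanSolveHomogeneous σ →
      -- one algorithm handles all extensions; the input is the list of the triples `(αᵢ, κᵢ, lᵢ)`,
      -- where `τ xᵢ` is the sequence `κᵢ ∏_{lᵢ ≤ k < n} ev(αᵢ, k)`, and the list of the `dᵢ`;
      -- the output is `ρ` and the list of the triples `(ḡᵢ, νᵢ, cᵢ)`
      ∃ algo : List (F × F × ℕ) × List ℕ →. F × List (F × ℕ × F), Partrec algo ∧
        ∀ (u s : ℕ) (hu : 0 < u) (H : Type v) [CommRing H] [Algebra F H] (σH : H ≃+* H)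
          (x : Fin (u + s) → Hˣ) (α : Fin (u + s) → Fˣ) (τ : H →+* SeqRing (constField σ))
          (d : Fin u → ℕ) (κ : Fin (u + s) → constField σ) (l : Fin (u + s) → ℕ),
          SpecialCase σ τF σH x α τ d →
          (∀ i, τ (x i) = toSeq fun n => κ i * ∏ k ∈ Finset.Ico (l i) n, ev (α i) k) →
          ∃ (ρ : constField σ) (ν : Fin u → ℕ) (g : Fin u → Fˣ) (c : Fin u → constField σ)
            (σE : tailRing F x ≃+* tailRing F x),
            ((ρ : F), List.ofFn fun i => ((g i : F), ν i, (c i : F))) ∈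
              algo (List.ofFn fun i => ((α i : F), (κ i : F), l i), List.ofFn d) ∧
            TailStatement σ σH x α τ σE ∧
            IsComputableDiffRing (laurentRep (F := F) (tailGen F x)) σE ∧
            (lastEntry hu d = 1 → ∃ lam : H →+* tailRing F x,
              PiFactorization σ σH x α τ d σE g c lam ∧
              ComputableVia (laurentRep (F := F) x) (laurentRep (F := F) (tailGen F x)) lam) ∧
            (lastEntry hu d ≠ 1 → 1 < lastEntry hu d ∧
              ∃ (B : Type v) (_ : CommRing B) (_ : Algebra (tailRing F x) B) (σB : B ≃+* B)
                (z : B) (τ' : B →+* SeqRing (constField σ)) (lam : H →+* B),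
                RFactorization σ σH x α τ d (lastEntry hu d) σE ρ ν g c σB z τ' lam ∧
                IsComputableDiffRing (laurentRootRep (F := F) (tailGen F x) z) σB ∧
                ComputableVia (laurentRep (F := F) x)
                  (laurentRootRep (F := F) (tailGen F x) z) lam)) := by
  refine ⟨?_, ?_⟩
  · intro u s hu H _ _ σH x α τ d h
    obtain ⟨σE, hσE⟩ := h.isPExtension.exists_tail_aut
    have hE := h.tailStatement hσE
    obtain ⟨ρ, ν, g, c, hR⟩ := h.exists_isReduction hσ hu
    refine ⟨σE, hE, fun hd => ?_, fun hd => ?_⟩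
    · rw [hd] at hR
      exact ⟨g, c, h.exists_piFactorization hR hE⟩
    · have hn : 1 < lastEntry hu d := lt_of_le_of_ne (h.d_pos _) (Ne.symm hd)
      exact ⟨hn, ρ, ν, g, c, h.exists_rFactorization hR rfl hn hE⟩
  · intro _ ev L Z hF hO _
    obtain ⟨f, hf, hspec⟩ := Partrec.exists_uniformization (computablePred_outputCheck hF hO)
    refine ⟨fun a => (f a).map Prod.snd, hf.map (Computable.snd.comp .snd), ?_⟩
    intro u s hu H _ _ σH x α τ d κ l h hx
    obtain ⟨out, hmem, hout⟩ := hspec _ (h.exists_outputCheck (L := L) hO.tau_eq hσ hu hx)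
    obtain ⟨ρ, ν, g, c, heq, hR⟩ := h.isReduction_of_outputCheck hO.tau_eq hO.isOSigmaFunction
      hO.isEvaluation hu hx hout
    obtain ⟨σE, hσE⟩ := h.isPExtension.exists_tail_aut
    have hE := h.tailStatement hσE
    refine ⟨ρ, ν, g, c, σE, heq ▸ Part.mem_map Prod.snd hmem, hE,
      hE.isPiExtension.toIsPExtension.isComputableDiffRing hF, fun hd => ?_, fun hd => ?_⟩
    · rw [hd] at hR
      obtain ⟨lam, hlam⟩ := h.exists_piFactorization hR hE
      exact ⟨lam, hlam, hlam.computableVia hF⟩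
    · have hn : 1 < lastEntry hu d := lt_of_le_of_ne (h.d_pos _) (Ne.symm hd)
      obtain ⟨B, _, _, σB, z, τ', lam, hB⟩ := h.exists_rFactorization hR rfl hn hE
      exact ⟨hn, B, inferInstance, inferInstance, σB, z, τ', lam, hB,
        IsAExtension.isComputableDiffRing hE.isPiExtension.toIsPExtension
          hB.isRExtension.toIsAExtension hF, hB.computableVia hF⟩
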